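/- Let $\omega_A,\omega_c\in\mathbb R$, $\gamma\ge 0$, $g,z\in\mathbb C$, put $\Delta\omega=\omega_A-\omega_c$, $\Gamma=-i\Delta\omega+\frac12\gamma$, and assume $\Gamma\neq0$. Let $b$ be the annihilation operator of a bosonic mode $B$, let $\sigma^-=|0\rangle\langle1|$, $\sigma^+=|1\rangle\langle0|$ act on a two-level system $A$, and let $$\mathcal L_0=-i[\omega_A\sigma^+\sigma^-+\omega_c b^\dagger b,\,\cdot\,]+\gamma\Big(b\cdot b^\dagger-\tfrac12\{b^\dagger b,\cdot\}\Big),\qquad \mathcal L=-i[g\sigma^+b+\overline g\,\sigma^-b^\dagger,\,\cdot\,]$$ act on the operators on $\mathbb C^2\otimes\ell^2(\mathbb N)$ whose matrix elements in the Fock basis decay faster than every exponential of the photon numbers; on this space the series $e^{\mathcal L_0t}=\sum_n t^n\mathcal L_0^n/n!$ converges matrix element by matrix element for every $t\in\mathbb R$. Let $|z\rangle$ be the coherent state, $b|z\rangle=z|z\rangle$, $\langle z|z\rangle=1$, let $\mathcal P=\operatorname{tr}_B(\cdot)\otimes|z\rangle\langle z|$ and $\mathcal L(t)=e^{-\mathcal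 L_0t}\mathcal Le^{\mathcal L_0t}$. Define the moments $$\mathcal O_0(t)=\mathcal Pe^{\mathcal L_0t}\mathcal P,\quad \mathcal O_1(t)=\int_0^t dt_1\,\mathcal Pe^{\mathcal L_0t}\mathcal L(t_1)\mathcal P,\quad \mathcal O_2(t)=\int_0^t dt_1\int_0^{t_1}dt_2\,\mathcal Pe^{\mathcal L_0t}\mathcal L(t_1)\mathcal L(t_2)\mathcal P,$$ regarded as maps of the (finite-dimensional) range of $\mathcal P$, and the second-order time-convolutionless cumulant $$\mathcal K_2=\dot{\mathcal O}_2\mathcal O_0^{-1}-\dot{\mathcal O}_1\mathcal O_0^{-1}\mathcal O_1\mathcal O_0^{-1}-\dot{\mathcal O}_0\mathcal O_0^{-1}\mathcal O_2\mathcal O_0^{-1}+\dot{\mathcal O}_0\mathcal O_0^{-1}\mathcal O_1\mathcal O_0^{-1}\mathcal O_1\mathcal O_0^{-1},$$ extended to all operators by $\mathcal K_2\rho:=\mathcal K_2\mathcal P\rho$. Then the integrands are continuous, the moments are differentiable, $\mathcal O_0(t)$ is invertible on the range of $\mathcal P$, and, for all $t\ge0$ and all $\rho$, with $\rho_A=\operatorname{tr}_B\rho$,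 $$\mathcal K_2(t)\rho=\bigg(-\frac{i|g|^2}{2|\Gamma|^2}\big(2\Delta\omega+\varphi_2(t)\big)[\sigma^+\sigma^-,\rho_A]+\frac{|g|^2}{|\Gamma|^2}\big(\gamma+f_2(t)\big)\Big(\sigma^-\rho_A\sigma^+-\tfrac12\{\sigma^+\sigma^-,\rho_A\}\Big)\bigg)\otimes|z\rangle\langle z|,$$ where $|\Gamma|^2=\Delta\omega^2+\frac14\gamma^2$ and $$f_2(t)=e^{-\frac12\gamma t}\big(2\Delta\omega\sin(\Delta\omega t)-\gamma\cos(\Delta\omega t)\big),\qquad \varphi_2(t)=e^{-\frac12\gamma t}\big(-2\Delta\omega\cos(\Delta\omega t)-\gamma\sin(\Delta\omega t)\big).$$ If moreover $\gamma>0$, then as $t\to\infty$ the cumulant, as a map of $2\times2$ matrices $\rho_A$ (with the factor $\otimes|z\rangle\langle z|$ omitted), converges to the GKSL generator $$\rho_A\mapsto-i[H^{(2)},\rho_A]+L^{(2)}\rho_AL^{(2)\dagger}-\tfrac12\{L^{(2)\dagger}L^{(2)},\rho_A\},\qquad H^{(2)}=\frac{\Delta\omega|g|^2}{|\Gamma|^2}\sigma^+\sigma^-,\quad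 L^{(2)}=\frac{\sqrt\gamma\,|g|}{|\Gamma|}\sigma^-,$$ with $H^{(2)}$ Hermitian. -/

import Mathlib

open Filter Topology
open scoped ComplexConjugate

noncomputable section

namespace DissipativeJC

/-- Operators on the two-level system `A`; index `0` is the ground state, index `1` the excited
state. -/
abbrev OpA : Type := Matrix (Fin 2) (Fin 2) ℂ

/-- Matrices of operators on `ℂ² ⊗ ℓ²(ℕ)` in the product of the atomic basis and the Fock (number)
basis: `ρ (a, m) (c, n) = ⟨a, m| ρ |c, n⟩`. -/
abbrev FockMatrix : Type := Matrix (Fin 2 × ℕ) (Fin 2 × ℕ) ℂ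

/-- The lowering operator `σ⁻ = |0⟩⟨1|`. -/
def sigmaMinus : OpA := !![0, 1; 0, 0]

/-- The raising operator `σ⁺ = |1⟩⟨0|`. -/
def sigmaPlus : OpA := !![0, 0; 1, 0]

/-- `‖ρ (a, m) (c, n)‖ r ^ (m + n) ≤ C` for all matrix elements. -/
def WeightBound (r C : ℝ) (ρ : FockMatrix) : Prop :=
  ∀ i j, ‖ρ i j‖ * r ^ (i.2 + j.2) ≤ C

/-- The space of operators of system and mode on which the superoperators act: matrix elements in
the Fock basis decay faster than every exponential of the photon numbers. It is a space of
trace-class operators, contains `ρ_A ⊗ |z⟩⟨z|` for every coherent state, and is invariant under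
multiplication by `b`, `b†`, `σ^±`, under the free evolution (which is given there by the
convergent exponential series), and under the projector. -/
def OpAB : Submodule ℂ FockMatrix where
  carrier := {ρ | ∀ r : ℝ, 1 ≤ r → ∃ C : ℝ, WeightBound r C ρ}
  add_mem' := by
    intro x y hx hy r hr
    obtain ⟨C, hC⟩ := hx r hr
    obtain ⟨D, hD⟩ := hy r hr
    refine ⟨C + D, fun i j => ?_⟩
    have h0 : 0 ≤ r ^ (i.2 + j.2) := by positivity
    calc ‖(x + y) i j‖ * r ^ (i.2 + j.2)
        ≤ (‖x i j‖ + ‖y i j‖) * r ^ (i.2 + j.2) :=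
          mul_le_mul_of_nonneg_right (norm_add_le _ _) h0
      _ ≤ C + D := by rw [add_mul]; exact add_le_add (hC i j) (hD i j)
  zero_mem' := fun r _ => ⟨0, fun i j => by simp⟩
  smul_mem' := by
    intro c x hx r hr
    obtain ⟨C, hC⟩ := hx r hr
    refine ⟨‖c‖ * C, fun i j => ?_⟩
    have h := mul_le_mul_of_nonneg_left (hC i j) (norm_nonneg c)
    simpa [mul_assoc] using h

theorem WeightBound.nonneg {r C : ℝ} {ρ : FockMatrix} (h : WeightBound r C ρ) : 0 ≤ C := by
  have := h (0, 0) (0, 0)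
  simp only [add_zero, pow_zero, mul_one] at this
  exact (norm_nonneg _).trans this

theorem mem_of_shift {ρ σ : FockMatrix} (hρ : ρ ∈ OpAB)
    (h : ∀ i j, ∃ i' j' : Fin 2 × ℕ, ‖σ i j‖ ≤ ((i.2 + j.2 : ℕ) + 1 : ℝ) * ‖ρ i' j'‖ ∧
      i.2 + j.2 ≤ i'.2 + j'.2 + 1) : σ ∈ OpAB := by
  intro r hr
  obtain ⟨C, hC⟩ := hρ (2 * r) (by linarith)
  refine ⟨C * (2 * r), fun i j => ?_⟩
  obtain ⟨i', j', h1, h2⟩ := h i j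
  set N := i.2 + j.2 with hN
  have hC0 := hC.nonneg
  have hle : ((N : ℝ) + 1) ≤ 2 ^ N := by
    have := Nat.lt_two_pow_self (n := N)
    exact_mod_cast this
  have hr0 : (0 : ℝ) ≤ r ^ N := by positivity
  have hpow : (2 * r) ^ N ≤ (2 * r) ^ (i'.2 + j'.2 + 1) :=
    pow_le_pow_right₀ (by linarith) h2
  calc ‖σ i j‖ * r ^ N ≤ (((N : ℝ) + 1) * ‖ρ i' j'‖) * r ^ N :=
        mul_le_mul_of_nonneg_right h1 hr0
    _ ≤ (2 ^ N * ‖ρ i' j'‖) * r ^ N := by gcongr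
    _ = ‖ρ i' j'‖ * (2 * r) ^ N := by rw [mul_pow]; ring
    _ ≤ ‖ρ i' j'‖ * (2 * r) ^ (i'.2 + j'.2 + 1) := by gcongr
    _ = (‖ρ i' j'‖ * (2 * r) ^ (i'.2 + j'.2)) * (2 * r) := by ring
    _ ≤ C * (2 * r) := by
        have := hC i' j'
        gcongr

theorem norm_sqrt_mul_le (k N : ℕ) (h : k ≤ N + 1) (x : ℂ) :
    ‖((Real.sqrt k : ℝ) : ℂ) * x‖ ≤ ((N : ℝ) + 1) * ‖x‖ := by
  rw [norm_mul, Complex.norm_real, Real.norm_of_nonneg (Real.sqrt_nonneg _)]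
  gcongr
  have hk : (k : ℝ) ≤ N + 1 := by exact_mod_cast h
  refine (Real.sqrt_le_sqrt hk).trans ?_
  rw [Real.sqrt_le_left (by positivity)]
  nlinarith [(Nat.cast_nonneg N : (0 : ℝ) ≤ N)]

/-- `ρ ↦ b ρ`, where `⟨m| b = √(m+1) ⟨m+1|`. -/
def leftB : Module.End ℂ OpAB where
  toFun ρ := ⟨Matrix.of fun i j => ((Real.sqrt (i.2 + 1 : ℕ) : ℝ) : ℂ) * ρ.1 (i.1, i.2 + 1) j,
    mem_of_shift ρ.2 fun i j => ⟨(i.1, i.2 + 1), j, norm_sqrt_mul_le _ _ (by omega) _,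
      by simp only; omega⟩⟩
  map_add' x y := by ext i j; simp [mul_add]
  map_smul' c x := by ext i j; simp [mul_left_comm]

/-- `ρ ↦ b† ρ`, where `⟨m| b† = √m ⟨m-1|`. -/
def leftBdag : Module.End ℂ OpAB where
  toFun ρ := ⟨Matrix.of fun i j => ((Real.sqrt (i.2 : ℕ) : ℝ) : ℂ) * ρ.1 (i.1, i.2 - 1) j,
    mem_of_shift ρ.2 fun i j => ⟨(i.1, i.2 - 1), j, norm_sqrt_mul_le _ _ (by omega) _,
      by simp only; omega⟩⟩
  map_add' x y := by ext i j; simp [mul_add]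
  map_smul' c x := by ext i j; simp [mul_left_comm]

/-- `ρ ↦ ρ b`, where `b |n⟩ = √n |n-1⟩`. -/
def rightB : Module.End ℂ OpAB where
  toFun ρ := ⟨Matrix.of fun i j => ((Real.sqrt (j.2 : ℕ) : ℝ) : ℂ) * ρ.1 i (j.1, j.2 - 1),
    mem_of_shift ρ.2 fun i j => ⟨i, (j.1, j.2 - 1), norm_sqrt_mul_le _ _ (by omega) _,
      by simp only; omega⟩⟩
  map_add' x y := by ext i j; simp [mul_add]
  map_smul' c x := by ext i j; simp [mul_left_comm]

/-- `ρ ↦ ρ b†`, where `b† |n⟩ = √(n+1) |n+1⟩`. -/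
def rightBdag : Module.End ℂ OpAB where
  toFun ρ := ⟨Matrix.of fun i j => ((Real.sqrt (j.2 + 1 : ℕ) : ℝ) : ℂ) * ρ.1 i (j.1, j.2 + 1),
    mem_of_shift ρ.2 fun i j => ⟨i, (j.1, j.2 + 1), norm_sqrt_mul_le _ _ (by omega) _,
      by simp only; omega⟩⟩
  map_add' x y := by ext i j; simp [mul_add]
  map_smul' c x := by ext i j; simp [mul_left_comm]

theorem mem_of_entry {ρ : OpAB} (p q : Fin 2 × ℕ → Fin 2 × ℕ)
    (hp : ∀ i, (p i).2 = i.2) (hq : ∀ i, (q i).2 = i.2) :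
    (Matrix.of fun i j => ρ.1 (p i) (q j) : FockMatrix) ∈ OpAB := by
  refine mem_of_shift ρ.2 fun i j => ⟨p i, q j, ?_, by rw [hp, hq]; omega⟩
  exact le_mul_of_one_le_left (norm_nonneg _) (by
    have : (0 : ℝ) ≤ ((i.2 + j.2 : ℕ) : ℝ) := Nat.cast_nonneg _
    linarith)

theorem mem_of_mul_entry {σ : FockMatrix} (hσ : σ ∈ OpAB) (w : Fin 2 → ℂ)
    (u : Fin 2 × ℕ → Fin 2 × ℕ → Fin 2) : (Matrix.of fun i j => w (u i j) * σ i j : FockMatrix) ∈ OpAB := by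
  intro r hr
  obtain ⟨C, hC⟩ := hσ r hr
  refine ⟨(‖w 0‖ + ‖w 1‖) * C, fun i j => ?_⟩
  have hw : ∀ a, ‖w a‖ ≤ ‖w 0‖ + ‖w 1‖ := by
    intro a
    fin_cases a
    · simp
    · simp
  change ‖w (u i j) * σ i j‖ * r ^ (i.2 + j.2) ≤ _
  rw [norm_mul, mul_assoc]
  exact mul_le_mul (hw _) (hC i j) (by positivity) (by positivity)

/-- `ρ ↦ (M ⊗ 1) ρ`. -/
def leftA (M : OpA) : Module.End ℂ OpAB where
  toFun ρ := ⟨Matrix.of fun i j => ∑ c, M i.1 c * ρ.1 (c, i.2) j, by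
    have h : ∀ c, (Matrix.of fun i j => M i.1 c * ρ.1 (c, i.2) j : FockMatrix) ∈ OpAB := fun c =>
      mem_of_mul_entry (mem_of_entry (ρ := ρ) (fun i => (c, i.2)) id (fun _ => rfl) (fun _ => rfl))
        (fun a => M a c) (fun i _ => i.1)
    have := OpAB.add_mem (h 0) (h 1)
    refine (congrArg (· ∈ OpAB) ?_).mpr this
    ext i j
    simp [Fin.sum_univ_two]⟩
  map_add' x y := by ext i j; simp [Fin.sum_univ_two]; ring
  map_smul' c x := by ext i j; simp [Fin.sum_univ_two]; ring

/-- `ρ ↦ ρ (M ⊗ 1)`. -/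
def rightA (M : OpA) : Module.End ℂ OpAB where
  toFun ρ := ⟨Matrix.of fun i j => ∑ c, ρ.1 i (c, j.2) * M c j.1, by
    have h : ∀ c, (Matrix.of fun i j => M c j.1 * ρ.1 i (c, j.2) : FockMatrix) ∈ OpAB := fun c =>
      mem_of_mul_entry (mem_of_entry (ρ := ρ) id (fun j => (c, j.2)) (fun _ => rfl) (fun _ => rfl))
        (fun a => M c a) (fun _ j => j.1)
    have := OpAB.add_mem (h 0) (h 1)
    refine (congrArg (· ∈ OpAB) ?_).mpr this
    ext i j
    simp [Fin.sum_univ_two, mul_comm]⟩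
  map_add' x y := by ext i j; simp [Fin.sum_univ_two]; ring
  map_smul' c x := by ext i j; simp [Fin.sum_univ_two]; ring

/-- The dissipator `𝒟 = γ (b · b† - ½ {b† b, ·})`. -/
def dissipator (γ : ℝ) : Module.End ℂ OpAB :=
  (γ : ℂ) • (leftB * rightBdag - (1 / 2 : ℂ) • (leftBdag * leftB + rightB * rightBdag))

/-- The free generator `ℒ₀ = -i [ω_A σ⁺σ⁻ + ω_c b†b, ·] + 𝒟`. -/
def freeGen (ωA ωc γ : ℝ) : Module.End ℂ OpAB :=
  (-Complex.I) • ((ωA : ℂ) • (leftA (sigmaPlus * sigmaMinus) - rightA (sigmaPlus * sigmaMinus)) +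
      (ωc : ℂ) • (leftBdag * leftB - rightB * rightBdag)) + dissipator γ

/-- The interaction generator `ℒ = -i [g σ⁺ b + ḡ σ⁻ b†, ·]`. -/
def intGen (g : ℂ) : Module.End ℂ OpAB :=
  (-Complex.I) •
    ((g • (leftA sigmaPlus * leftB) + conj g • (leftA sigmaMinus * leftBdag)) -
      (g • (rightA sigmaPlus * rightB) + conj g • (rightA sigmaMinus * rightBdag)))

/-- The population of the excited state in the first index. -/
def exc (a : Fin 2) : ℂ := if a = 1 then 1 else 0

theorem freeGen_apply (ωA ωc γ : ℝ) (ρ : OpAB) (i j : Fin 2 × ℕ) :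
    (freeGen ωA ωc γ ρ).1 i j =
      (-Complex.I * (ωA * (exc i.1 - exc j.1) + ωc * ((i.2 : ℂ) - j.2))
          - γ / 2 * ((i.2 : ℂ) + j.2)) * ρ.1 i j
        + γ * ((Real.sqrt (i.2 + 1 : ℕ) : ℝ) : ℂ) * ((Real.sqrt (j.2 + 1 : ℕ) : ℝ) : ℂ)
          * ρ.1 (i.1, i.2 + 1) (j.1, j.2 + 1) := by
  have hs : ∀ m : ℕ, ((Real.sqrt m : ℝ) : ℂ) * ((Real.sqrt m : ℝ) : ℂ) = m := by
    intro m
    rw [← Complex.ofReal_mul, Real.mul_self_sqrt (Nat.cast_nonneg _), Complex.ofReal_natCast]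
  have hl : (leftBdag (leftB ρ)).1 i j = (i.2 : ℂ) * ρ.1 i j := by
    obtain ⟨a, m⟩ := i
    rcases m with _ | m
    · simp [leftBdag]
    · change ((Real.sqrt (m + 1 : ℕ) : ℝ) : ℂ) * (((Real.sqrt (m + 1 : ℕ) : ℝ) : ℂ) *
        ρ.1 (a, m + 1) j) = _
      rw [← mul_assoc, hs]
  have hr : (rightB (rightBdag ρ)).1 i j = (j.2 : ℂ) * ρ.1 i j := by
    obtain ⟨a, m⟩ := j
    rcases m with _ | m
    · simp [rightB]
    · change ((Real.sqrt (m + 1 : ℕ) : ℝ) : ℂ) * (((Real.sqrt (m + 1 : ℕ) : ℝ) : ℂ) *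
        ρ.1 i (a, m + 1)) = _
      rw [← mul_assoc, hs]
  have hlr : (leftB (rightBdag ρ)).1 i j = ((Real.sqrt (i.2 + 1 : ℕ) : ℝ) : ℂ) *
      (((Real.sqrt (j.2 + 1 : ℕ) : ℝ) : ℂ) * ρ.1 (i.1, i.2 + 1) (j.1, j.2 + 1)) := rfl
  have hAl : (leftA (sigmaPlus * sigmaMinus) ρ).1 i j = exc i.1 * ρ.1 i j := by
    obtain ⟨a, m⟩ := i
    fin_cases a <;> simp [leftA, exc, sigmaPlus, sigmaMinus, Matrix.mul_apply, Fin.sum_univ_two]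
  have hAr : (rightA (sigmaPlus * sigmaMinus) ρ).1 i j = exc j.1 * ρ.1 i j := by
    obtain ⟨a, m⟩ := j
    fin_cases a <;> simp [rightA, exc, sigmaPlus, sigmaMinus, Matrix.mul_apply, Fin.sum_univ_two]
  simp only [freeGen, dissipator, LinearMap.add_apply, LinearMap.smul_apply, LinearMap.sub_apply,
    Module.End.mul_apply, Submodule.coe_add, Submodule.coe_smul, Submodule.coe_sub,
    Matrix.add_apply, Matrix.smul_apply, Matrix.sub_apply, hl, hr, hlr, hAl, hAr, smul_eq_mul]
  ring

theorem norm_exc_le (a : Fin 2) : ‖exc a‖ ≤ 1 := by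
  unfold exc; split_ifs <;> simp

/-- A bound for the size of the coefficients of `ℒ₀`. -/
def rate (ωA ωc γ : ℝ) : ℝ := 2 * |ωA| + |ωc| + |γ|

theorem norm_freeGen_le (ωA ωc γ : ℝ) (ρ : OpAB) (i j : Fin 2 × ℕ) :
    ‖(freeGen ωA ωc γ ρ).1 i j‖ ≤ rate ωA ωc γ * ((i.2 + j.2 : ℕ) + 1 : ℝ) *
      (‖ρ.1 i j‖ + ‖ρ.1 (i.1, i.2 + 1) (j.1, j.2 + 1)‖) := by
  rw [freeGen_apply]
  have hm : (0 : ℝ) ≤ i.2 := Nat.cast_nonneg _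
  have hn : (0 : ℝ) ≤ j.2 := Nat.cast_nonneg _
  have h1 : ‖-Complex.I * (ωA * (exc i.1 - exc j.1) + ωc * ((i.2 : ℂ) - j.2))
      - γ / 2 * ((i.2 : ℂ) + j.2)‖ ≤ rate ωA ωc γ * ((i.2 + j.2 : ℕ) + 1 : ℝ) := by
    have e1 : ‖exc i.1 - exc j.1‖ ≤ 2 :=
      (norm_sub_le _ _).trans (by linarith [norm_exc_le i.1, norm_exc_le j.1])
    have e2 : ‖(i.2 : ℂ) - j.2‖ ≤ (i.2 : ℝ) + j.2 :=
      (norm_sub_le _ _).trans (by simp)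
    have e3 : ‖(i.2 : ℂ) + j.2‖ ≤ (i.2 : ℝ) + j.2 :=
      (norm_add_le _ _).trans (by simp)
    calc _ ≤ ‖-Complex.I * (ωA * (exc i.1 - exc j.1) + ωc * ((i.2 : ℂ) - j.2))‖
          + ‖(γ / 2 : ℂ) * ((i.2 : ℂ) + j.2)‖ := norm_sub_le _ _
      _ ≤ (|ωA| * 2 + |ωc| * (i.2 + j.2)) + |γ| / 2 * (i.2 + j.2) := by
        gcongr
        · rw [norm_mul, norm_neg, Complex.norm_I, one_mul]
          refine (norm_add_le _ _).trans ?_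
          rw [norm_mul, norm_mul, Complex.norm_real, Complex.norm_real, Real.norm_eq_abs,
            Real.norm_eq_abs]
          gcongr
        · rw [norm_mul, norm_div, Complex.norm_real, Real.norm_eq_abs]
          simp only [Complex.norm_ofNat]
          gcongr
      _ ≤ _ := by
        unfold rate
        push_cast
        have := mul_nonneg (abs_nonneg ωA) (add_nonneg hm hn)
        have := mul_nonneg (abs_nonneg γ) (add_nonneg hm hn)
        nlinarith [abs_nonneg ωA, abs_nonneg ωc, abs_nonneg γ]
  have h2 : ‖(γ : ℂ) * ((Real.sqrt (i.2 + 1 : ℕ) : ℝ) : ℂ) * ((Real.sqrt (j.2 + 1 : ℕ) : ℝ) : ℂ)‖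
      ≤ rate ωA ωc γ * ((i.2 + j.2 : ℕ) + 1 : ℝ) := by
    rw [norm_mul, norm_mul, Complex.norm_real, Complex.norm_real, Complex.norm_real,
      Real.norm_eq_abs, Real.norm_of_nonneg (Real.sqrt_nonneg _),
      Real.norm_of_nonneg (Real.sqrt_nonneg _)]
    have e : Real.sqrt (i.2 + 1 : ℕ) * Real.sqrt (j.2 + 1 : ℕ) ≤ (i.2 + j.2 : ℕ) + 1 := by
      have a1 := Real.mul_self_sqrt (Nat.cast_nonneg (α := ℝ) (i.2 + 1))
      have a2 := Real.mul_self_sqrt (Nat.cast_nonneg (α := ℝ) (j.2 + 1))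
      have a3 := sq_nonneg (Real.sqrt (i.2 + 1 : ℕ) - Real.sqrt (j.2 + 1 : ℕ))
      push_cast at a1 a2 a3 ⊢
      nlinarith
    rw [mul_assoc]
    have e' : |γ| ≤ rate ωA ωc γ := by
      unfold rate; linarith [abs_nonneg ωA, abs_nonneg ωc]
    exact mul_le_mul e' e (by positivity) ((abs_nonneg _).trans e')
  refine (norm_add_le _ _).trans ?_
  rw [mul_add (rate ωA ωc γ * _)]
  refine add_le_add ?_ ?_
  · rw [norm_mul]
    exact mul_le_mul_of_nonneg_right h1 (norm_nonneg _)
  · rw [norm_mul]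
    exact mul_le_mul_of_nonneg_right h2 (norm_nonneg _)

theorem rate_nonneg (ωA ωc γ : ℝ) : 0 ≤ rate ωA ωc γ := by unfold rate; positivity

theorem weightBound_freeGen (ωA ωc γ : ℝ) {r q C : ℝ} (hr : 1 ≤ r) (hq0 : 0 < q) (hq1 : q < 1)
    (ρ : OpAB) (h : WeightBound (r / q) C ρ.1) :
    WeightBound r (2 * rate ωA ωc γ / (1 - q) * C) (freeGen ωA ωc γ ρ).1 := by
  intro i j
  have hC := h.nonneg
  have hrq : 1 ≤ r / q := by rw [le_div_iff₀ hq0]; linarith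
  set N := i.2 + j.2 with hN
  have hc := rate_nonneg ωA ωc γ
  have hgeo : ((N : ℝ) + 1) * q ^ N ≤ 1 / (1 - q) := by
    have h1 : ((N : ℝ) + 1) * q ^ N ≤ ∑ k ∈ Finset.range (N + 1), q ^ k := by
      have : ∑ _k ∈ Finset.range (N + 1), q ^ N ≤ ∑ k ∈ Finset.range (N + 1), q ^ k := by
        refine Finset.sum_le_sum fun k hk => ?_
        exact pow_le_pow_of_le_one hq0.le hq1.le (by simp at hk; omega)
      simpa using this
    refine h1.trans ?_
    rw [one_div, ← tsum_geometric_of_lt_one hq0.le hq1]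
    exact (summable_geometric_of_lt_one hq0.le hq1).sum_le_tsum _ (fun _ _ => by positivity)
  have hb1 : ‖ρ.1 i j‖ * (r / q) ^ N ≤ C := h i j
  have hb2 : ‖ρ.1 (i.1, i.2 + 1) (j.1, j.2 + 1)‖ * (r / q) ^ N ≤ C := by
    refine le_trans ?_ (h (i.1, i.2 + 1) (j.1, j.2 + 1))
    refine mul_le_mul_of_nonneg_left (pow_le_pow_right₀ hrq ?_) (norm_nonneg _)
    simp only [hN]; omega
  have hrw : r ^ N = (r / q) ^ N * q ^ N := by
    rw [← mul_pow, div_mul_cancel₀ _ hq0.ne']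
  calc ‖(freeGen ωA ωc γ ρ).1 i j‖ * r ^ N
      ≤ (rate ωA ωc γ * ((N : ℝ) + 1) *
      (‖ρ.1 i j‖ + ‖ρ.1 (i.1, i.2 + 1) (j.1, j.2 + 1)‖)) * r ^ N := by
        gcongr; exact norm_freeGen_le ωA ωc γ ρ i j
    _ = rate ωA ωc γ * (((N : ℝ) + 1) * q ^ N) * (‖ρ.1 i j‖ * (r / q) ^ N +
        ‖ρ.1 (i.1, i.2 + 1) (j.1, j.2 + 1)‖ * (r / q) ^ N) := by rw [hrw]; ring
    _ ≤ rate ωA ωc γ * (1 / (1 - q)) * (C + C) := by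
        have : 0 ≤ 1 / (1 - q) := by rw [one_div]; exact inv_nonneg.mpr (by linarith)
        gcongr
    _ = _ := by ring

theorem weightBound_freeGen_pow (ωA ωc γ : ℝ) {r q C : ℝ} (hr : 1 ≤ r) (hq0 : 0 < q) (hq1 : q < 1)
    (ρ : OpAB) (n : ℕ) (h : WeightBound (r / q ^ n) C ρ.1) :
    WeightBound r ((2 * rate ωA ωc γ / (1 - q)) ^ n * C) ((freeGen ωA ωc γ ^ n) ρ).1 := by
  induction n generalizing r with
  | zero => simpa using h
  | succ n ih =>
    have h1 : 1 ≤ r / q := by rw [le_div_iff₀ hq0]; linarith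
    have h2 := ih h1 (by rwa [div_div, ← pow_succ'])
    have h3 := weightBound_freeGen ωA ωc γ hr hq0 hq1 _ h2
    rw [pow_succ' (freeGen ωA ωc γ), Module.End.mul_apply, pow_succ', mul_assoc]
    exact h3

/-- Geometric decay of the terms of the exponential series of `t ℒ₀`. -/
theorem exists_weightBound_series (ωA ωc γ t : ℝ) (ρ : OpAB) {r : ℝ} (hr : 1 ≤ r) :
    ∃ C : ℝ, ∀ n i j, ‖((t ^ n / n.factorial : ℝ) : ℂ) * ((freeGen ωA ωc γ ^ n) ρ).1 i j‖ *
      r ^ (i.2 + j.2) ≤ C * (1 / 2) ^ n := by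
  set x := |t| * (2 * rate ωA ωc γ) with hx
  have hc := rate_nonneg ωA ωc γ
  have hx0 : 0 ≤ x := by positivity
  set a := 2 * Real.exp 1 * x + 1 with ha
  have ha0 : 0 < a := by positivity
  obtain ⟨C, hC⟩ := ρ.2 (r * Real.exp a) (by
    have := Real.one_le_exp ha0.le
    nlinarith)
  have hC0 := hC.nonneg
  refine ⟨C * Real.exp a, fun n i j => ?_⟩
  rcases Nat.eq_zero_or_pos n with rfl | hn
  · have h1 : WeightBound r C ρ.1 := fun i j => by
      refine le_trans ?_ (hC i j)
      have := Real.one_le_exp ha0.le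
      gcongr
      nlinarith
    have h2 := h1 i j
    have h3 : C ≤ C * Real.exp a := le_mul_of_one_le_right hC0 (Real.one_le_exp ha0.le)
    simpa using h2.trans h3
  have hn0 : (0 : ℝ) < n := by exact_mod_cast hn
  set q := Real.exp (-(a / n)) with hq
  have hq0 : 0 < q := Real.exp_pos _
  have hq1 : q < 1 := by rw [hq, Real.exp_lt_one_iff]; linarith [div_pos ha0 hn0]
  have hqn : r / q ^ n = r * Real.exp a := by
    rw [hq, ← Real.exp_nat_mul, div_eq_mul_inv, ← Real.exp_neg]
    congr 2
    field_simp
  have hb := weightBound_freeGen_pow ωA ωc γ hr hq0 hq1 ρ n (hqn ▸ hC) i j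
  have hinv : 1 / (1 - q) ≤ (a + n) / a := by
    have h1 : q ≤ n / (a + n) := by
      rw [hq, Real.exp_neg, inv_le_comm₀ (Real.exp_pos _) (by positivity), inv_div]
      have := Real.add_one_le_exp (a / n)
      have e : (a + n) / n = a / n + 1 := by field_simp
      linarith
    rw [div_le_div_iff₀ (by linarith) ha0]
    have h2 : q * (a + n) ≤ n := (le_div_iff₀ (by positivity)).mp h1
    nlinarith
  rw [norm_mul, Complex.norm_real, Real.norm_eq_abs, abs_div, abs_pow,
    abs_of_nonneg (Nat.cast_nonneg (α := ℝ) n.factorial), mul_assoc]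
  have hqi : 0 ≤ 1 / (1 - q) := by rw [one_div]; exact inv_nonneg.mpr (by linarith)
  calc |t| ^ n / n.factorial * (‖((freeGen ωA ωc γ ^ n) ρ).1 i j‖ * r ^ (i.2 + j.2))
      ≤ |t| ^ n / n.factorial * ((2 * rate ωA ωc γ / (1 - q)) ^ n * C) := by gcongr
    _ = C * ((x * (1 / (1 - q))) ^ n / n.factorial) := by rw [hx]; ring
    _ ≤ C * ((x * ((a + n) / a)) ^ n / n.factorial) := by gcongr
    _ = C * ((x / a) ^ n * ((a + n) ^ n / n.factorial)) := by
        rw [show x * ((a + n) / a) = x / a * (a + n) by ring, mul_pow]; ring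
    _ ≤ C * ((x / a) ^ n * Real.exp (a + n)) := by
        gcongr
        exact Real.pow_div_factorial_le_exp _ (by positivity) n
    _ = C * Real.exp a * (x * Real.exp 1 / a) ^ n := by
        rw [Real.exp_add, show (n : ℝ) = n * 1 by ring, Real.exp_nat_mul, mul_div_right_comm,
          mul_pow]
        ring
    _ ≤ C * Real.exp a * (1 / 2) ^ n := by
        have h : x * Real.exp 1 / a ≤ 1 / 2 := by
          rw [div_le_iff₀ ha0, ha]
          linarith
        gcongr

theorem summable_series (ωA ωc γ t : ℝ) (ρ : OpAB) (i j : Fin 2 × ℕ) :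
    Summable fun n : ℕ => ((t ^ n / n.factorial : ℝ) : ℂ) * ((freeGen ωA ωc γ ^ n) ρ).1 i j := by
  obtain ⟨C, hC⟩ := exists_weightBound_series ωA ωc γ t ρ le_rfl
  refine Summable.of_norm_bounded
    (summable_geometric_two.mul_left C) fun n => ?_
  simpa using hC n i j

/-- The free evolution `e^{ℒ₀ t} = ∑ₙ tⁿ ℒ₀ⁿ / n!` (for all real `t`), matrix element by matrix
element; the series converges absolutely on `OpAB`. -/
def freeEvol (ωA ωc γ t : ℝ) : Module.End ℂ OpAB where
  toFun ρ := ⟨Matrix.of fun i j =>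
      ∑' n : ℕ, ((t ^ n / n.factorial : ℝ) : ℂ) * ((freeGen ωA ωc γ ^ n) ρ).1 i j, by
    intro r hr
    obtain ⟨C, hC⟩ := exists_weightBound_series ωA ωc γ t ρ hr
    refine ⟨C * 2, fun i j => ?_⟩
    have hs : Summable fun n : ℕ => C * (1 / 2 : ℝ) ^ n := summable_geometric_two.mul_left C
    have hpos : 0 < r ^ (i.2 + j.2) := by positivity
    have hb : ∀ n : ℕ, ‖((t ^ n / n.factorial : ℝ) : ℂ) * ((freeGen ωA ωc γ ^ n) ρ).1 i j‖ ≤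
        C * (1 / 2) ^ n * (r ^ (i.2 + j.2))⁻¹ := fun n => by
      rw [← div_eq_mul_inv, le_div_iff₀ hpos]; exact hC n i j
    have := tsum_of_norm_bounded (hs.hasSum.mul_right _) hb
    rw [tsum_mul_left, tsum_geometric_two, ← div_eq_mul_inv, le_div_iff₀ hpos] at this
    exact this⟩
  map_add' x y := by
    ext i j
    simp only [map_add, Submodule.coe_add, Matrix.add_apply, Matrix.of_apply, mul_add]
    exact (summable_series ωA ωc γ t x i j).tsum_add (summable_series ωA ωc γ t y i j)
  map_smul' c x := by
    ext i j
    simp only [map_smul, Submodule.coe_smul, Matrix.smul_apply, Matrix.of_apply, smul_eq_mul,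
      RingHom.id_apply, ← tsum_mul_left]
    exact tsum_congr fun n => by ring

theorem summable_diag (ρ : OpAB) (a c : Fin 2) : Summable fun n : ℕ => ρ.1 (a, n) (c, n) := by
  obtain ⟨C, hC⟩ := ρ.2 2 (by norm_num)
  refine Summable.of_norm_bounded (summable_geometric_two.mul_left C) fun n => ?_
  have h := hC (a, n) (c, n)
  have hC0 := hC.nonneg
  have h2 : ‖ρ.1 (a, n) (c, n)‖ * 2 ^ n ≤ C := by
    refine le_trans ?_ h
    gcongr
    · norm_num
    · exact Nat.le_add_right n n
  rw [one_div, inv_pow, ← div_eq_mul_inv, le_div_iff₀ (by positivity)]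
  exact h2

/-- The partial trace over the mode, `tr_B ρ = ∑ₙ ⟨n| ρ |n⟩`. -/
def trB : OpAB →ₗ[ℂ] OpA where
  toFun ρ := Matrix.of fun a c => ∑' n : ℕ, ρ.1 (a, n) (c, n)
  map_add' x y := by
    ext a c
    simpa using (summable_diag x a c).tsum_add (summable_diag y a c)
  map_smul' k x := by
    ext a c
    simp [tsum_mul_left]

/-- The coherent state `|z⟩`, `⟨n|z⟩ = e^{-|z|²/2} zⁿ / √n!`. -/
def coherent (z : ℂ) (n : ℕ) : ℂ :=
  ((Real.exp (-‖z‖ ^ 2 / 2) : ℝ) : ℂ) * (z ^ n / ((Real.sqrt n.factorial : ℝ) : ℂ))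

/-- `b |z⟩ = z |z⟩`. -/
theorem b_coherent (z : ℂ) (n : ℕ) :
    ((Real.sqrt (n + 1 : ℕ) : ℝ) : ℂ) * coherent z (n + 1) = z * coherent z n := by
  unfold coherent
  have h1 : ((Real.sqrt (n + 1 : ℕ) : ℝ) : ℂ) ≠ 0 := by
    exact_mod_cast (Real.sqrt_pos.mpr (by positivity)).ne'
  have h2 : ((Real.sqrt n.factorial : ℝ) : ℂ) ≠ 0 := by
    exact_mod_cast (Real.sqrt_pos.mpr (by positivity)).ne'
  rw [Nat.factorial_succ, Nat.cast_mul, Real.sqrt_mul (Nat.cast_nonneg _), Complex.ofReal_mul]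
  field_simp
  exact pow_succ' z n

theorem norm_coherent_sq (z : ℂ) (n : ℕ) :
    ‖coherent z n‖ ^ 2 = Real.exp (-‖z‖ ^ 2) * ((‖z‖ ^ 2) ^ n / n.factorial) := by
  unfold coherent
  rw [norm_mul, norm_div, norm_pow, Complex.norm_real, Complex.norm_real,
    Real.norm_of_nonneg (Real.exp_pos _).le, Real.norm_of_nonneg (Real.sqrt_nonneg _), mul_pow,
    div_pow, Real.sq_sqrt (Nat.cast_nonneg _), ← Real.exp_nat_mul, ← pow_mul, ← pow_mul,
    mul_comm n 2]
  congr 2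
  push_cast
  ring

/-- `⟨z|z⟩ = 1`. -/
theorem hasSum_coherent (z : ℂ) :
    HasSum (fun n => coherent z n * conj (coherent z n)) 1 := by
  have h : HasSum (fun n => ‖coherent z n‖ ^ 2) 1 := by
    have := (NormedSpace.expSeries_div_hasSum_exp (𝔸 := ℝ) (‖z‖ ^ 2)).mul_left
      (Real.exp (-‖z‖ ^ 2))
    rw [← Real.exp_eq_exp_ℝ, ← Real.exp_add, neg_add_cancel, Real.exp_zero] at this
    simpa only [norm_coherent_sq] using this
  have h2 := Complex.hasSum_ofReal.mpr h
  simpa [Complex.mul_conj, Complex.normSq_eq_norm_sq] using h2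

theorem exists_coherent_bound (z : ℂ) (r : ℝ) (hr : 1 ≤ r) :
    ∃ K, 0 ≤ K ∧ ∀ n, ‖coherent z n‖ * r ^ n ≤ K := by
  refine ⟨Real.sqrt (Real.exp ((‖z‖ * r) ^ 2)), Real.sqrt_nonneg _, fun n => ?_⟩
  apply Real.le_sqrt_of_sq_le
  rw [mul_pow, norm_coherent_sq]
  have h1 : Real.exp (-‖z‖ ^ 2) ≤ 1 := by
    rw [Real.exp_le_one_iff]; nlinarith [sq_nonneg ‖z‖]
  calc Real.exp (-‖z‖ ^ 2) * ((‖z‖ ^ 2) ^ n / n.factorial) * (r ^ n) ^ 2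
      ≤ 1 * ((‖z‖ ^ 2) ^ n / n.factorial) * (r ^ n) ^ 2 := by gcongr
    _ = ((‖z‖ * r) ^ 2) ^ n / n.factorial := by ring
    _ ≤ _ := Real.pow_div_factorial_le_exp _ (by positivity) n

/-- `ρ_A ↦ ρ_A ⊗ |z⟩⟨z|`. -/
def tensorCoherent (z : ℂ) : OpA →ₗ[ℂ] OpAB where
  toFun ρA := ⟨Matrix.of fun i j => ρA i.1 j.1 * (coherent z i.2 * conj (coherent z j.2)), by
    intro r hr
    obtain ⟨K, hK0, hK⟩ := exists_coherent_bound z r hr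
    refine ⟨(∑ a, ∑ c, ‖ρA a c‖) * (K * K), fun i j => ?_⟩
    have h1 : ‖ρA i.1 j.1‖ ≤ ∑ a, ∑ c, ‖ρA a c‖ :=
      (Finset.single_le_sum (f := fun c => ‖ρA i.1 c‖) (fun _ _ => norm_nonneg _)
        (Finset.mem_univ j.1)).trans
      (Finset.single_le_sum (f := fun a => ∑ c, ‖ρA a c‖)
        (fun _ _ => Finset.sum_nonneg fun _ _ => norm_nonneg _) (Finset.mem_univ i.1))
    have h2 := mul_le_mul (hK i.2) (hK j.2) (by positivity) hK0
    rw [Matrix.of_apply, norm_mul, norm_mul, RCLike.norm_conj, pow_add]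
    calc _ = ‖ρA i.1 j.1‖ * (‖coherent z i.2‖ * r ^ i.2 * (‖coherent z j.2‖ * r ^ j.2)) := by ring
      _ ≤ _ := mul_le_mul h1 h2 (by positivity) ((norm_nonneg _).trans h1)⟩
  map_add' x y := by ext i j; simp [add_mul]
  map_smul' c x := by ext i j; simp [mul_assoc]

theorem trB_tensorCoherent (z : ℂ) (ρA : OpA) : trB (tensorCoherent z ρA) = ρA := by
  ext a c
  have := ((hasSum_coherent z).mul_left (ρA a c)).tsum_eq
  simpa [trB, tensorCoherent] using this

/-- The projector `𝒫 = tr_B(·) ⊗ |z⟩⟨z|`. -/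
def projector (z : ℂ) : Module.End ℂ OpAB := tensorCoherent z ∘ₗ trB

open scoped Matrix.Norms.L2Operator

/-- Superoperators on the two-level system: linear maps on `2 × 2` matrices, as a normed algebra. -/
abbrev SuperA : Type := OpA →L[ℂ] OpA

/-- The superoperator `ρ_A ↦ tr_B (𝒴 (ρ_A ⊗ |z⟩⟨z|))` that represents `𝒫 𝒴 𝒫` on the range of `𝒫`,
which is identified with the `2 × 2` matrices through `ρ_A ↔ ρ_A ⊗ |z⟩⟨z|`. -/
def compress (z : ℂ) (Y : Module.End ℂ OpAB) : SuperA :=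
  LinearMap.toContinuousLinearMap (trB ∘ₗ Y ∘ₗ tensorCoherent z)

/-- The superoperator `tr_B(·) ↦ k (tr_B(·)) ⊗ |z⟩⟨z|` of system and mode that corresponds to `k`
under that identification. -/
def extend (z : ℂ) (k : SuperA) : Module.End ℂ OpAB :=
  tensorCoherent z ∘ₗ k.toLinearMap ∘ₗ trB

theorem extend_compress (z : ℂ) (Y : Module.End ℂ OpAB) :
    extend z (compress z Y) = projector z * Y * projector z := rfl

theorem extend_mul (z : ℂ) (k l : SuperA) : extend z (k * l) = extend z k * extend z l := by
  ext1 ρ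
  simp [extend, trB_tensorCoherent]

theorem extend_one (z : ℂ) : extend z 1 = projector z := rfl

/-- `ℒ(t) = e^{-ℒ₀ t} ℒ e^{ℒ₀ t}`. -/
def intGenAt (ωA ωc γ : ℝ) (g : ℂ) (t : ℝ) : Module.End ℂ OpAB :=
  freeEvol ωA ωc γ (-t) * intGen g * freeEvol ωA ωc γ t

/-- The moment `𝒪₀(t) = 𝒫 e^{ℒ₀ t} 𝒫`, on the range of `𝒫`. -/
def moment0 (ωA ωc γ : ℝ) (z : ℂ) (t : ℝ) : SuperA :=
  compress z (freeEvol ωA ωc γ t)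

/-- `𝒫 e^{ℒ₀ t} ℒ(t₁) 𝒫`, on the range of `𝒫`. -/
def integrand1 (ωA ωc γ : ℝ) (g z : ℂ) (t t₁ : ℝ) : SuperA :=
  compress z (freeEvol ωA ωc γ t * intGenAt ωA ωc γ g t₁)

/-- `𝒫 e^{ℒ₀ t} ℒ(t₁) ℒ(t₂) 𝒫`, on the range of `𝒫`. -/
def integrand2 (ωA ωc γ : ℝ) (g z : ℂ) (t t₁ t₂ : ℝ) : SuperA :=
  compress z (freeEvol ωA ωc γ t * intGenAt ωA ωc γ g t₁ * intGenAt ωA ωc γ g t₂)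

/-- The moment `𝒪₁(t) = ∫₀ᵗ dt₁ 𝒫 e^{ℒ₀ t} ℒ(t₁) 𝒫`, on the range of `𝒫`. -/
def moment1 (ωA ωc γ : ℝ) (g z : ℂ) (t : ℝ) : SuperA :=
  ∫ t₁ in (0 : ℝ)..t, integrand1 ωA ωc γ g z t t₁

/-- The moment `𝒪₂(t) = ∫₀ᵗ dt₁ ∫₀^{t₁} dt₂ 𝒫 e^{ℒ₀ t} ℒ(t₁) ℒ(t₂) 𝒫`, on the range of `𝒫`. -/
def moment2 (ωA ωc γ : ℝ) (g z : ℂ) (t : ℝ) : SuperA :=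
  ∫ t₁ in (0 : ℝ)..t, ∫ t₂ in (0 : ℝ)..t₁, integrand2 ωA ωc γ g z t t₁ t₂

/-- The second-order cumulant
`𝒦₂ = 𝒪̇₂ 𝒪₀⁻¹ - 𝒪̇₁ 𝒪₀⁻¹ 𝒪₁ 𝒪₀⁻¹ - 𝒪̇₀ 𝒪₀⁻¹ 𝒪₂ 𝒪₀⁻¹ + 𝒪̇₀ 𝒪₀⁻¹ 𝒪₁ 𝒪₀⁻¹ 𝒪₁ 𝒪₀⁻¹`,
on the range of `𝒫`. -/
def cumulant2 (ωA ωc γ : ℝ) (g z : ℂ) (t : ℝ) : SuperA :=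
  let O₀ := moment0 ωA ωc γ z
  let O₁ := moment1 ωA ωc γ g z
  let O₂ := moment2 ωA ωc γ g z
  let R := Ring.inverse (O₀ t)
  deriv O₂ t * R - deriv O₁ t * R * O₁ t * R - deriv O₀ t * R * O₂ t * R
    + deriv O₀ t * R * O₁ t * R * O₁ t * R

/-- The dissipator `ρ_A ↦ L ρ_A L† - ½ {L† L, ρ_A}`. -/
def lindbladDissipator (L : OpA) : OpA →ₗ[ℂ] OpA :=
  LinearMap.mulLeft ℂ L ∘ₗ LinearMap.mulRight ℂ L.conjTranspose
    - (1 / 2 : ℂ) • (LinearMap.mulLeft ℂ (L.conjTranspose * L)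
      + LinearMap.mulRight ℂ (L.conjTranspose * L))

/-- The generator `ρ_A ↦ -i [H, ρ_A] + L ρ_A L† - ½ {L† L, ρ_A}`; it is a GKSL generator when `H`
is Hermitian. -/
def gksl (H L : OpA) : SuperA :=
  LinearMap.toContinuousLinearMap
    ((-Complex.I) • (LinearMap.mulLeft ℂ H - LinearMap.mulRight ℂ H) + lindbladDissipator L)

/-- `Γ = -i Δω + γ/2`. -/
def Γ (Δω γ : ℝ) : ℂ := -Complex.I * Δω + γ / 2

/-- `f₂(t) = e^{-γt/2} (2 Δω sin(Δω t) - γ cos(Δω t))`. -/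
def f₂ (Δω γ t : ℝ) : ℝ :=
  Real.exp (-(1 / 2) * γ * t) * (2 * Δω * Real.sin (Δω * t) - γ * Real.cos (Δω * t))

/-- `φ₂(t) = e^{-γt/2} (-2 Δω cos(Δω t) - γ sin(Δω t))`. -/
def φ₂ (Δω γ t : ℝ) : ℝ :=
  Real.exp (-(1 / 2) * γ * t) * (-2 * Δω * Real.cos (Δω * t) - γ * Real.sin (Δω * t))

end DissipativeJC

end

open DissipativeJC

open Filter Topology
open scoped ComplexConjugate

noncomputable section

namespace DissipativeJC

/-! The dissipative mode is quasi-free, and at the level of superoperators it looks like two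
harmonic oscillators. The maps `leftB` : ρ ↦ bρ and `rightBdag` : ρ ↦ ρb† act as annihilators, and
the commutators `creL` : ρ ↦ [b†, ρ] and `creR` : ρ ↦ [ρ, b] as their creators. Each pair is
canonical and the two pairs commute. With κ = γ/2 + iω_c the free generator takes the normal form ℒ₀
= (atomic commutator) - κ `creL` `leftB` - κ̄ `creR` `rightBdag` (`freeGen_eq`). Every factor of ℒ
is therefore an eigenvector of ad ℒ₀, and ℒ(t) is an explicit sum of four terms with exponential
coefficients (`intGenAt_eq`).

The projector supplies both vacuum conditions: tr_B annihilates the range of a creator, by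
cyclicity, and |z⟩⟨z| is an eigenvector of both annihilators. Normal ordering (Wick's theorem with
one contraction) then gives tr_B ℒ(t)|z⟩⟨z| = D(t), the classical drive, and tr_B ℒ(t)ℒ(s)|z⟩⟨z| =
D(t)D(s) + N(t - s), where the z-independent kernel N comes from the contraction
(`compress_intGenAt_mul_intGenAt`). Moreover tr_B intertwines e^{ℒ₀t} with the atomic rotation, so V
= 𝒪₀ factors out on the left of every moment.

Thus 𝒪₁ = V∫D and 𝒪₂ = V∬(DD + N). In the cumulant all terms with V̇ or D cancel, which leaves V
(∫₀ᵗ N) V⁻¹ (`secondCumulant_eq`). N is covariant under atomic phase rotations, hence commutes with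
V, and 𝒦₂ = ∫₀ᵗ N. This is governed by the single number (1 - e^{-Γt})/Γ: its real part is the decay
rate and its imaginary part the level shift, up to factors.

The analytic work is in the exponential series, which converges only matrix element by matrix
element: the group law, commutation with eigenoperators and exchange with the partial trace each
need a rearrangement of series. -/

/-! ### Multiplication superoperators and their commutation relations -/

theorem end_sub_eq (X Y : Module.End ℂ OpAB) : X - Y = X + (-1 : ℂ) • Y := by
  ext1 ρ
  rw [LinearMap.sub_apply, LinearMap.add_apply, LinearMap.smul_apply, neg_one_smul, sub_eq_add_neg]

/-- The creation superoperator `ρ ↦ [b†, ρ]`; together with `leftB` it forms a canonical pair. -/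
def creL : Module.End ℂ OpAB := leftBdag + (-1 : ℂ) • rightBdag

/-- The creation superoperator `ρ ↦ [ρ, b]`; together with `rightBdag` it forms a canonical pair. -/
def creR : Module.End ℂ OpAB := rightB + (-1 : ℂ) • leftB

theorem ofReal_sqrt_mul_self (m : ℕ) :
    ((Real.sqrt m : ℝ) : ℂ) * ((Real.sqrt m : ℝ) : ℂ) = m := by
  rw [← Complex.ofReal_mul, Real.mul_self_sqrt (Nat.cast_nonneg _), Complex.ofReal_natCast]

theorem leftB_mul_leftBdag : leftB * leftBdag = leftBdag * leftB + 1 := by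
  ext ρ ⟨a, m⟩ j
  have h : (leftB (leftBdag ρ)).1 (a, m) j = ((m + 1 : ℕ) : ℂ) * ρ.1 (a, m) j := by
    rw [← ofReal_sqrt_mul_self, mul_assoc]; rfl
  have h' : (leftBdag (leftB ρ)).1 (a, m) j = (m : ℂ) * ρ.1 (a, m) j := by
    -- At m = 0 the index m - 1 is truncated, which is harmless because its coefficient is √0.
    rcases m with _ | m
    · simp [leftBdag]
    · rw [← ofReal_sqrt_mul_self, mul_assoc]; rfl
  simp only [Module.End.mul_apply, LinearMap.add_apply, Submodule.coe_add, Matrix.add_apply,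
    Module.End.one_apply, h, h']
  push_cast; ring

theorem rightBdag_mul_rightB : rightBdag * rightB = rightB * rightBdag + 1 := by
  ext ρ i ⟨c, n⟩
  have h : (rightBdag (rightB ρ)).1 i (c, n) = ((n + 1 : ℕ) : ℂ) * ρ.1 i (c, n) := by
    rw [← ofReal_sqrt_mul_self, mul_assoc]; rfl
  have h' : (rightB (rightBdag ρ)).1 i (c, n) = (n : ℂ) * ρ.1 i (c, n) := by
    rcases n with _ | n
    · simp [rightB]
    · rw [← ofReal_sqrt_mul_self, mul_assoc]; rfl
  simp only [Module.End.mul_apply, LinearMap.add_apply, Submodule.coe_add, Matrix.add_apply,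
    Module.End.one_apply, h, h']
  push_cast; ring

theorem commute_leftB_rightB : Commute leftB rightB := by
  ext ρ i j; simp [leftB, rightB, mul_left_comm]

theorem commute_leftB_rightBdag : Commute leftB rightBdag := by
  ext ρ i j; simp [leftB, rightBdag, mul_left_comm]

theorem commute_leftBdag_rightB : Commute leftBdag rightB := by
  ext ρ i j; simp [leftBdag, rightB, mul_left_comm]

theorem commute_leftBdag_rightBdag : Commute leftBdag rightBdag := by
  ext ρ i j; simp [leftBdag, rightBdag, mul_left_comm]

theorem commute_leftA_rightA (M K : OpA) : Commute (leftA M) (rightA K) := by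
  ext ρ i j; simp [leftA, rightA, Fin.sum_univ_two]; ring

theorem commute_leftA_leftB (M : OpA) : Commute (leftA M) leftB := by
  ext ρ i j; simp [leftA, leftB, Fin.sum_univ_two]; ring

theorem commute_leftA_leftBdag (M : OpA) : Commute (leftA M) leftBdag := by
  ext ρ i j; simp [leftA, leftBdag, Fin.sum_univ_two]; ring

theorem commute_leftA_rightB (M : OpA) : Commute (leftA M) rightB := by
  ext ρ i j; simp [leftA, rightB, Fin.sum_univ_two]; ring

theorem commute_leftA_rightBdag (M : OpA) : Commute (leftA M) rightBdag := by
  ext ρ i j; simp [leftA, rightBdag, Fin.sum_univ_two]; ring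

theorem commute_rightA_leftB (M : OpA) : Commute (rightA M) leftB := by
  ext ρ i j; simp [rightA, leftB, Fin.sum_univ_two]; ring

theorem commute_rightA_leftBdag (M : OpA) : Commute (rightA M) leftBdag := by
  ext ρ i j; simp [rightA, leftBdag, Fin.sum_univ_two]; ring

theorem commute_rightA_rightB (M : OpA) : Commute (rightA M) rightB := by
  ext ρ i j; simp [rightA, rightB, Fin.sum_univ_two]; ring

theorem commute_rightA_rightBdag (M : OpA) : Commute (rightA M) rightBdag := by
  ext ρ i j; simp [rightA, rightBdag, Fin.sum_univ_two]; ring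

theorem commute_leftA_creL (M : OpA) : Commute (leftA M) creL :=
  (commute_leftA_leftBdag M).add_right ((commute_leftA_rightBdag M).smul_right _)

theorem commute_leftA_creR (M : OpA) : Commute (leftA M) creR :=
  (commute_leftA_rightB M).add_right ((commute_leftA_leftB M).smul_right _)

theorem commute_rightA_creL (M : OpA) : Commute (rightA M) creL :=
  (commute_rightA_leftBdag M).add_right ((commute_rightA_rightBdag M).smul_right _)

theorem commute_rightA_creR (M : OpA) : Commute (rightA M) creR :=
  (commute_rightA_rightB M).add_right ((commute_rightA_leftB M).smul_right _)

theorem leftB_mul_creL : leftB * creL = creL * leftB + 1 := by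
  rw [creL, mul_add, add_mul, mul_smul_comm, smul_mul_assoc, leftB_mul_leftBdag,
    commute_leftB_rightBdag.eq]
  module

theorem rightBdag_mul_creR : rightBdag * creR = creR * rightBdag + 1 := by
  rw [creR, mul_add, add_mul, mul_smul_comm, smul_mul_assoc, rightBdag_mul_rightB,
    commute_leftB_rightBdag.eq]
  module

theorem commute_leftB_creR : Commute leftB creR :=
  commute_leftB_rightB.add_right ((Commute.refl _).smul_right _)

theorem commute_rightBdag_creL : Commute rightBdag creL :=
  commute_leftBdag_rightBdag.symm.add_right ((Commute.refl _).smul_right _)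

/-- The left multiplications b† and b contribute +1 to the commutator and the right multiplications
-1, so the two contributions cancel. -/
theorem commute_creL_creR : Commute creL creR := by
  have h1 := leftB_mul_leftBdag
  have h2 := rightBdag_mul_rightB
  have h3 := commute_leftBdag_rightB.eq
  have h4 := commute_leftB_rightBdag.eq
  rw [commute_iff_eq, creL, creR]
  simp only [mul_add, add_mul, mul_smul_comm, smul_mul_assoc, h1, h2, h3, h4]
  module

/-! ### Normal form of the free generator and its eigenoperators -/

/-- The complex decay rate `γ/2 + i ω_c` of the mode. -/
def modeRate (ωc γ : ℝ) : ℂ := γ / 2 + Complex.I * ωc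

theorem conj_modeRate (ωc γ : ℝ) : conj (modeRate ωc γ) = γ / 2 - Complex.I * ωc := by
  simp [modeRate, Complex.conj_ofReal, map_ofNat]; ring

/-- The free generator of the two-level system alone. -/
def atomGen (ωA : ℝ) : Module.End ℂ OpAB :=
  (-Complex.I * ωA) •
    (leftA (sigmaPlus * sigmaMinus) + (-1 : ℂ) • rightA (sigmaPlus * sigmaMinus))

/-- The jump term γ bρb† is split between the two oscillators according to γ = κ + κ̄, with κ =
`modeRate ωc γ`. -/
theorem freeGen_eq (ωA ωc γ : ℝ) :
    freeGen ωA ωc γ = atomGen ωA + (-modeRate ωc γ) • (creL * leftB)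
      + (-conj (modeRate ωc γ)) • (creR * rightBdag) := by
  rw [conj_modeRate, freeGen, dissipator, atomGen, modeRate, creL, creR]
  simp only [end_sub_eq, add_mul, smul_mul_assoc, commute_leftB_rightBdag.eq]
  module

/-- The superoperator `Y` satisfies `[T, Y] = μ Y`. -/
def IsEigenop (T : Module.End ℂ OpAB) (μ : ℂ) (Y : Module.End ℂ OpAB) : Prop :=
  T * Y = Y * T + μ • Y

/-- The commutator with `T` is a derivation, so eigenvalues add under products. -/
theorem IsEigenop.mul {T Y Z : Module.End ℂ OpAB} {μ ν : ℂ} (hY : IsEigenop T μ Y)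
    (hZ : IsEigenop T ν Z) : IsEigenop T (μ + ν) (Y * Z) := by
  unfold IsEigenop at *
  rw [← mul_assoc, hY, add_mul, mul_assoc, hZ]
  simp only [mul_add, mul_smul_comm, smul_mul_assoc, mul_assoc]
  module

theorem IsEigenop.add {T Y Z : Module.End ℂ OpAB} {μ : ℂ} (hY : IsEigenop T μ Y)
    (hZ : IsEigenop T μ Z) : IsEigenop T μ (Y + Z) := by
  unfold IsEigenop at *
  rw [mul_add, hY, hZ, add_mul]
  module

theorem IsEigenop.smul {T Y : Module.End ℂ OpAB} {μ : ℂ} (hY : IsEigenop T μ Y) (c : ℂ) :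
    IsEigenop T μ (c • Y) := by
  unfold IsEigenop at *
  rw [mul_smul_comm, hY, smul_mul_assoc]
  module

/-- Only -κ `creL` `leftB` fails to commute with `leftB`, and [`creL`, `leftB`] = -1 turns its
commutator into +κ `leftB`. The creators obtain the opposite sign in the same way. -/
theorem isEigenop_leftB (ωA ωc γ : ℝ) :
    IsEigenop (freeGen ωA ωc γ) (modeRate ωc γ) leftB := by
  have hA : Commute (atomGen ωA) leftB :=
    ((commute_leftA_leftB _).add_left ((commute_rightA_leftB _).smul_left _)).smul_left _
  rw [IsEigenop, freeGen_eq]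
  simp only [add_mul, mul_add, smul_mul_assoc, mul_smul_comm, hA.eq]
  rw [← mul_assoc leftB creL, leftB_mul_creL, mul_assoc creR, ← commute_leftB_rightBdag.eq,
    ← mul_assoc leftB creR, commute_leftB_creR.eq, mul_assoc creR, add_mul, one_mul]
  module

theorem isEigenop_rightBdag (ωA ωc γ : ℝ) :
    IsEigenop (freeGen ωA ωc γ) (conj (modeRate ωc γ)) rightBdag := by
  have hA : Commute (atomGen ωA) rightBdag :=
    ((commute_leftA_rightBdag _).add_left ((commute_rightA_rightBdag _).smul_left _)).smul_left _
  rw [IsEigenop, freeGen_eq]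
  simp only [add_mul, mul_add, smul_mul_assoc, mul_smul_comm, hA.eq]
  rw [← mul_assoc rightBdag creR, rightBdag_mul_creR, mul_assoc creL, commute_leftB_rightBdag.eq,
    ← mul_assoc rightBdag creL, commute_rightBdag_creL.eq, mul_assoc creL, add_mul, one_mul]
  module

theorem isEigenop_creL (ωA ωc γ : ℝ) :
    IsEigenop (freeGen ωA ωc γ) (-modeRate ωc γ) creL := by
  have hA : Commute (atomGen ωA) creL :=
    ((commute_leftA_creL _).add_left ((commute_rightA_creL _).smul_left _)).smul_left _
  rw [IsEigenop, freeGen_eq]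
  simp only [add_mul, mul_add, smul_mul_assoc, mul_smul_comm, hA.eq]
  rw [mul_assoc creL leftB, leftB_mul_creL, mul_assoc creR, commute_rightBdag_creL.eq,
    ← mul_assoc creL creR, commute_creL_creR.eq, mul_assoc creR, mul_add, mul_one]
  module

theorem isEigenop_creR (ωA ωc γ : ℝ) :
    IsEigenop (freeGen ωA ωc γ) (-conj (modeRate ωc γ)) creR := by
  have hA : Commute (atomGen ωA) creR :=
    ((commute_leftA_creR _).add_left ((commute_rightA_creR _).smul_left _)).smul_left _
  rw [IsEigenop, freeGen_eq]
  simp only [add_mul, mul_add, smul_mul_assoc, mul_smul_comm, hA.eq]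
  rw [mul_assoc creR rightBdag, rightBdag_mul_creR, mul_assoc creL, commute_leftB_creR.eq,
    ← mul_assoc creL creR, commute_creL_creR.eq, mul_assoc creR creL, mul_add, mul_one]
  module

theorem IsEigenop.of_atomGen {ωA ωc γ : ℝ} {μ : ℂ} {Y : Module.End ℂ OpAB}
    (h : IsEigenop (atomGen ωA) μ Y) (h1 : Commute Y leftB) (h2 : Commute Y rightBdag)
    (h3 : Commute Y creL) (h4 : Commute Y creR) : IsEigenop (freeGen ωA ωc γ) μ Y := by
  unfold IsEigenop at *
  rw [freeGen_eq, add_mul, add_mul, h, smul_mul_assoc, smul_mul_assoc, mul_add, mul_add,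
    mul_smul_comm, mul_smul_comm, (h3.mul_right h1).eq, (h4.mul_right h2).eq]
  module

theorem isEigenop_leftA {ωA ωc γ : ℝ} {M : OpA} {μ : ℂ}
    (h : (-Complex.I * ωA) • (sigmaPlus * sigmaMinus * M - M * (sigmaPlus * sigmaMinus)) = μ • M) :
    IsEigenop (freeGen ωA ωc γ) μ (leftA M) := by
  refine IsEigenop.of_atomGen ?_ (commute_leftA_leftB M) (commute_leftA_rightBdag M)
    (commute_leftA_creL M) (commute_leftA_creR M)
  have hmul : ∀ K L : OpA, leftA K * leftA L = leftA (K * L) := fun K L => by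
    ext ρ i j; simp [leftA, Fin.sum_univ_two, Matrix.mul_apply]; ring
  have hsub : ∀ K L : OpA, leftA K + (-1 : ℂ) • leftA L = leftA (K - L) := fun K L => by
    ext ρ i j; simp [leftA, Fin.sum_univ_two]; ring
  have hsmul : ∀ (c : ℂ) (K : OpA), c • leftA K = leftA (c • K) := fun c K => by
    ext ρ i j; simp [leftA, Fin.sum_univ_two]; ring
  rw [IsEigenop, hsmul, ← h, ← hsmul, ← hsub, ← hmul _ M, ← hmul M, atomGen, smul_mul_assoc,
    mul_smul_comm, add_mul, mul_add, smul_mul_assoc, mul_smul_comm,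
    (commute_leftA_rightA M (sigmaPlus * sigmaMinus)).eq]
  module

/-- Right multiplication reverses products, and it enters `atomGen` with a minus sign. The two signs
cancel, so left and right multiplication by `M` have the same eigenvalue. -/
theorem isEigenop_rightA {ωA ωc γ : ℝ} {M : OpA} {μ : ℂ}
    (h : (-Complex.I * ωA) • (sigmaPlus * sigmaMinus * M - M * (sigmaPlus * sigmaMinus)) = μ • M) :
    IsEigenop (freeGen ωA ωc γ) μ (rightA M) := by
  refine IsEigenop.of_atomGen ?_ (commute_rightA_leftB M) (commute_rightA_rightBdag M)
    (commute_rightA_creL M) (commute_rightA_creR M)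
  have hmul : ∀ K L : OpA, rightA K * rightA L = rightA (L * K) := fun K L => by
    ext ρ i j; simp [rightA, Fin.sum_univ_two, Matrix.mul_apply]; ring
  have hsub : ∀ K L : OpA, rightA K + (-1 : ℂ) • rightA L = rightA (K - L) := fun K L => by
    ext ρ i j; simp [rightA, Fin.sum_univ_two]; ring
  have hsmul : ∀ (c : ℂ) (K : OpA), c • rightA K = rightA (c • K) := fun c K => by
    ext ρ i j; simp [rightA, Fin.sum_univ_two]; ring
  rw [IsEigenop, hsmul, ← h, ← hsmul, ← hsub, ← hmul M, ← hmul _ M, atomGen, smul_mul_assoc,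
    mul_smul_comm, add_mul, mul_add, smul_mul_assoc, mul_smul_comm,
    (commute_leftA_rightA (sigmaPlus * sigmaMinus) M).eq]
  module

theorem comm_sigmaPlus (ωA : ℝ) :
    (-Complex.I * ωA) • (sigmaPlus * sigmaMinus * sigmaPlus
      - sigmaPlus * (sigmaPlus * sigmaMinus)) = (-Complex.I * ωA) • sigmaPlus := by
  ext a c; fin_cases a <;> fin_cases c <;> simp [sigmaPlus, sigmaMinus]

theorem comm_sigmaMinus (ωA : ℝ) :
    (-Complex.I * ωA) • (sigmaPlus * sigmaMinus * sigmaMinus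
      - sigmaMinus * (sigmaPlus * sigmaMinus)) = (Complex.I * ωA) • sigmaMinus := by
  ext a c; fin_cases a <;> fin_cases c <;> simp [sigmaPlus, sigmaMinus]

/-! ### Superoperators that respect entrywise convergence -/

/-- `Y` maps matrix-element-wise convergent series to such series. -/
def EntrywiseContinuous (Y : Module.End ℂ OpAB) : Prop :=
  ∀ (x : ℕ → OpAB) (y : OpAB), (∀ i j, HasSum (fun n => (x n).1 i j) (y.1 i j)) →
    ∀ i j, HasSum (fun n => (Y (x n)).1 i j) ((Y y).1 i j)

namespace EntrywiseContinuous

variable {Y Z : Module.End ℂ OpAB}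

theorem one : EntrywiseContinuous 1 := fun _ _ h => h

theorem mul (hY : EntrywiseContinuous Y) (hZ : EntrywiseContinuous Z) :
    EntrywiseContinuous (Y * Z) :=
  fun x y h => hY (fun n => Z (x n)) (Z y) (hZ x y h)

theorem pow (hY : EntrywiseContinuous Y) (n : ℕ) : EntrywiseContinuous (Y ^ n) := by
  induction n with
  | zero => exact one
  | succ n ih => rw [pow_succ]; exact ih.mul hY

theorem add (hY : EntrywiseContinuous Y) (hZ : EntrywiseContinuous Z) :
    EntrywiseContinuous (Y + Z) :=
  fun x y h i j => (hY x y h i j).add (hZ x y h i j)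

theorem smul (hY : EntrywiseContinuous Y) (c : ℂ) : EntrywiseContinuous (c • Y) :=
  fun x y h i j => (hY x y h i j).mul_left c

theorem leftB : EntrywiseContinuous leftB := fun _ _ h _ _ => (h _ _).mul_left _

theorem leftBdag : EntrywiseContinuous leftBdag := fun _ _ h _ _ => (h _ _).mul_left _

theorem rightB : EntrywiseContinuous rightB := fun _ _ h _ _ => (h _ _).mul_left _

theorem rightBdag : EntrywiseContinuous rightBdag := fun _ _ h _ _ => (h _ _).mul_left _

theorem leftA (M : OpA) : EntrywiseContinuous (leftA M) :=
  fun _ _ h i j => hasSum_sum (s := Finset.univ)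
    fun c _ => (h (c, i.2) j).mul_left (M i.1 c)

theorem rightA (M : OpA) : EntrywiseContinuous (rightA M) :=
  fun _ _ h i j => hasSum_sum (s := Finset.univ)
    fun c _ => (h i (c, j.2)).mul_right (M c j.1)

theorem creL : EntrywiseContinuous creL := leftBdag.add (rightBdag.smul _)

theorem creR : EntrywiseContinuous creR := rightB.add (leftB.smul _)

theorem freeGen (ωA ωc γ : ℝ) : EntrywiseContinuous (freeGen ωA ωc γ) := by
  rw [freeGen_eq]
  exact ((((leftA _).add ((rightA _).smul _)).smul _).add ((creL.mul leftB).smul _)).add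
    ((creR.mul rightBdag).smul _)

end EntrywiseContinuous

/-! ### The exponential series as a one-parameter group -/

section freeEvol

variable (ωA ωc γ : ℝ)

theorem hasSum_freeEvol (t : ℝ) (ρ : OpAB) (i j : Fin 2 × ℕ) :
    HasSum (fun n : ℕ => ((t ^ n / n.factorial : ℝ) : ℂ) * ((freeGen ωA ωc γ ^ n) ρ).1 i j)
      ((freeEvol ωA ωc γ t ρ).1 i j) :=
  (summable_series ωA ωc γ t ρ i j).hasSum

theorem choose_div_factorial {n : ℕ} {p : ℕ × ℕ} (hp : p ∈ Finset.HasAntidiagonal.antidiagonal n) :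
    (n.choose p.1 : ℂ) / n.factorial = 1 / p.1.factorial * (1 / p.2.factorial) := by
  obtain rfl := Finset.HasAntidiagonal.mem_antidiagonal.mp hp
  have h : (((p.1 + p.2).choose p.2 * p.1.factorial * p.2.factorial : ℕ) : ℂ)
      = (p.1 + p.2).factorial := by
    rw [← Nat.add_choose_mul_factorial_mul_factorial]
  have h1 : (p.1.factorial : ℂ) ≠ 0 := by exact_mod_cast p.1.factorial_ne_zero
  have h2 : (p.2.factorial : ℂ) ≠ 0 := by exact_mod_cast p.2.factorial_ne_zero
  have h3 : ((p.1 + p.2).factorial : ℂ) ≠ 0 := by exact_mod_cast (p.1 + p.2).factorial_ne_zero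
  rw [div_mul_div_comm, div_eq_div_iff h3 (mul_ne_zero h1 h2), ← h,
    Nat.choose_symm_of_eq_add (rfl : p.1 + p.2 = p.1 + p.2)]
  push_cast
  ring

theorem add_pow_div_factorial (x y : ℂ) (n : ℕ) :
    (x + y) ^ n / n.factorial = ∑ p ∈ Finset.HasAntidiagonal.antidiagonal n,
      x ^ p.1 / p.1.factorial * (y ^ p.2 / p.2.factorial) := by
  rw [(Commute.all x y).add_pow', Finset.sum_div]
  refine Finset.sum_congr rfl fun p hp => ?_
  rw [nsmul_eq_mul, mul_div_right_comm, choose_div_factorial hp]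
  ring

theorem IsEigenop.pow_mul {T Y : Module.End ℂ OpAB} {μ : ℂ} (h : IsEigenop T μ Y) (n : ℕ) :
    T ^ n * Y = Y * (T + μ • 1) ^ n := by
  induction n with
  | zero => simp
  | succ n ih =>
    rw [pow_succ', mul_assoc, ih, ← mul_assoc, h, pow_succ', ← mul_assoc, mul_add, mul_smul_comm,
      mul_one]

/-- The matrix element `⟨i| Y ρ |j⟩` as a function of the superoperator `Y`. -/
def entry (ρ : OpAB) (i j : Fin 2 × ℕ) : Module.End ℂ OpAB →ₗ[ℂ] ℂ where
  toFun Y := (Y ρ).1 i j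
  map_add' _ _ := rfl
  map_smul' _ _ := rfl

theorem pow_add_smul_one_apply (T : Module.End ℂ OpAB) (μ t : ℂ) (n : ℕ) (ρ : OpAB)
    (i j : Fin 2 × ℕ) :
    t ^ n / n.factorial * (((T + μ • 1) ^ n) ρ).1 i j =
      ∑ p ∈ Finset.HasAntidiagonal.antidiagonal n,
        t ^ p.1 / p.1.factorial * ((T ^ p.1) ρ).1 i j * ((μ * t) ^ p.2 / p.2.factorial) := by
  have h := congrArg (entry ρ i j) (((Commute.one_right T).smul_right μ).add_pow' n)
  rw [map_sum] at h
  change (((T + μ • 1) ^ n) ρ).1 i j = _ at h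
  rw [h, Finset.mul_sum]
  refine Finset.sum_congr rfl fun p hp => ?_
  have h1 : entry ρ i j (T ^ p.1 * (μ • 1) ^ p.2) = μ ^ p.2 * ((T ^ p.1) ρ).1 i j := by
    rw [smul_pow, one_pow, mul_smul_comm, mul_one, map_smul, smul_eq_mul]; rfl
  rw [map_nsmul, h1, nsmul_eq_mul,
    show t ^ n / n.factorial * ((n.choose p.1 : ℂ) * (μ ^ p.2 * ((T ^ p.1) ρ).1 i j))
      = n.choose p.1 / n.factorial * (t ^ n * μ ^ p.2 * ((T ^ p.1) ρ).1 i j) by ring,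
    choose_div_factorial hp, ← Finset.HasAntidiagonal.mem_antidiagonal.mp hp]
  ring

/-- From TY = Y(T + μ) one gets TⁿY = Y(T + μ)ⁿ, and summation gives e^{tT}Y = Y e^{t(T + μ)}.
Entrywise continuity is what allows `Y` to be taken out of the series. -/
theorem IsEigenop.freeEvol_mul {μ : ℂ} {Y : Module.End ℂ OpAB}
    (h : IsEigenop (freeGen ωA ωc γ) μ Y) (hY : EntrywiseContinuous Y) (t : ℝ) :
    freeEvol ωA ωc γ t * Y = Complex.exp (μ * t) • (Y * freeEvol ωA ωc γ t) := by
  ext ρ i j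
  set T := freeGen ωA ωc γ
  -- The Cauchy product of the series of e^{tT}ρ and of e^{μt} is the series of e^{t(T + μ)}ρ, by
  -- the binomial theorem.
  have hx : ∀ i j, HasSum
      (fun n : ℕ => (((t ^ n / n.factorial : ℝ) : ℂ) • ((T + μ • 1) ^ n) ρ).1 i j)
      ((Complex.exp (μ * t) • freeEvol ωA ωc γ t ρ).1 i j) := by
    intro i j
    have h1 := (hasSum_freeEvol ωA ωc γ t ρ i j)
    have h2 : HasSum (fun n : ℕ => (μ * t) ^ n / n.factorial) (Complex.exp (μ * t)) := by
      rw [Complex.exp_eq_exp_ℂ]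
      exact NormedSpace.expSeries_div_hasSum_exp (𝔸 := ℂ) (μ * t)
    have h3 := tsum_mul_tsum_eq_tsum_sum_antidiagonal_of_summable_norm h1.summable.norm
      h2.summable.norm
    have h4 := (summable_norm_sum_mul_antidiagonal_of_summable_norm h1.summable.norm
      h2.summable.norm).of_norm.hasSum
    rw [← h3, h1.tsum_eq, h2.tsum_eq,
      mul_comm ((freeEvol ωA ωc γ t ρ).1 i j)] at h4
    refine HasSum.congr_fun h4 fun n => ?_
    have := pow_add_smul_one_apply T μ t n ρ i j
    rw [Submodule.coe_smul, Matrix.smul_apply, smul_eq_mul]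
    push_cast
    exact this
  have h1 := hY _ _ hx i j
  have h2 := hasSum_freeEvol ωA ωc γ t (Y ρ) i j
  refine h2.unique ?_
  have e : ((Complex.exp (μ * t) • (Y * freeEvol ωA ωc γ t)) ρ).1 i j
    = (Y (Complex.exp (μ * t) • freeEvol ωA ωc γ t ρ)).1 i j := by
    rw [map_smul]; rfl
  rw [e]
  refine HasSum.congr_fun h1 fun n => ?_
  rw [map_smul, ← Module.End.mul_apply, h.pow_mul, Module.End.mul_apply]
  rfl

/-- One absolutely convergent double series is summed in two ways: by rows it is e^{sT}e^{tT}, by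
antidiagonals e^{(s+t)T}. -/
theorem freeEvol_mul_freeEvol (s t : ℝ) :
    freeEvol ωA ωc γ s * freeEvol ωA ωc γ t = freeEvol ωA ωc γ (s + t) := by
  ext ρ i j
  set T := freeGen ωA ωc γ with hT
  set f : ℕ × ℕ → ℂ := fun p => (s : ℂ) ^ p.1 / p.1.factorial * ((t : ℂ) ^ p.2 / p.2.factorial) *
    ((T ^ (p.1 + p.2)) ρ).1 i j with hf
  -- On the n-th antidiagonal the norms add up to the norm of the n-th term of the series at time
  -- |s| + |t|, which is summable.
  have hsum : Summable f := by
    have h := (summable_series ωA ωc γ (|s| + |t|) ρ i j).norm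
    rw [← Finset.HasAntidiagonal.sigmaAntidiagonalEquivProd.summable_iff]
    refine Summable.of_norm ((summable_sigma_of_nonneg fun _ => norm_nonneg _).mpr
      ⟨fun n => Summable.of_finite, ?_⟩)
    refine (summable_congr fun n => ?_).mpr h
    rw [tsum_fintype, norm_mul, Complex.norm_real, Real.norm_of_nonneg (by positivity)]
    have h5 : (|s| + |t|) ^ n / n.factorial = ∑ p ∈ Finset.HasAntidiagonal.antidiagonal n,
        |s| ^ p.1 / p.1.factorial * (|t| ^ p.2 / p.2.factorial) := by
      have := add_pow_div_factorial (|s| : ℝ) (|t| : ℝ) n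
      exact_mod_cast this
    rw [h5, Finset.sum_mul, ← Finset.sum_coe_sort (Finset.HasAntidiagonal.antidiagonal n)]
    refine Finset.sum_congr rfl fun p _ => ?_
    have hp := Finset.HasAntidiagonal.mem_antidiagonal.mp p.2
    simp [Finset.HasAntidiagonal.sigmaAntidiagonalEquivProd, f, hp, hT]
  have hl : HasSum (fun k : ℕ => ((s ^ k / k.factorial : ℝ) : ℂ) *
      ((T ^ k) (freeEvol ωA ωc γ t ρ)).1 i j) (∑' p, f p) := by
    refine hsum.hasSum.prod_fiberwise fun k => ?_
    have h1 : ∀ i j, HasSum (fun n : ℕ => (((t ^ n / n.factorial : ℝ) : ℂ) • (T ^ n) ρ).1 i j)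
      ((freeEvol ωA ωc γ t ρ).1 i j) := hasSum_freeEvol ωA ωc γ t ρ
    have h2 := ((EntrywiseContinuous.freeGen ωA ωc γ).pow k _ _ h1 i j).mul_left
      ((s ^ k / k.factorial : ℝ) : ℂ)
    refine HasSum.congr_fun h2 fun n => ?_
    rw [map_smul, ← hT, ← Module.End.mul_apply, ← pow_add, Submodule.coe_smul, Matrix.smul_apply,
      smul_eq_mul]
    simp only [hf]
    push_cast
    ring
  have hr : HasSum (fun n : ℕ => (((s + t) ^ n / n.factorial : ℝ) : ℂ) * ((T ^ n) ρ).1 i j)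
      (∑' p, f p) := by
    refine (Finset.HasAntidiagonal.sigmaAntidiagonalEquivProd.hasSum_iff.mpr
      hsum.hasSum).sigma fun n => ?_
    have hfin := hasSum_fintype fun p : Finset.HasAntidiagonal.antidiagonal n =>
      f (Finset.HasAntidiagonal.sigmaAntidiagonalEquivProd ⟨n, p⟩)
    refine (congrArg (HasSum _) ?_).mpr hfin
    push_cast
    rw [add_pow_div_factorial, Finset.sum_mul, ← Finset.sum_attach, Finset.univ_eq_attach]
    refine Finset.sum_congr rfl fun p _ => ?_
    have hp := Finset.HasAntidiagonal.mem_antidiagonal.mp p.2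
    simp [Finset.HasAntidiagonal.sigmaAntidiagonalEquivProd, f, hp]
  exact ((hasSum_freeEvol ωA ωc γ s (freeEvol ωA ωc γ t ρ) i j).unique hl).trans
    (hr.unique (hasSum_freeEvol ωA ωc γ (s + t) ρ i j))

theorem freeEvol_zero : freeEvol ωA ωc γ 0 = 1 := by
  ext ρ i j
  refine (hasSum_freeEvol ωA ωc γ 0 ρ i j).unique ?_
  rw [Module.End.one_apply]
  refine HasSum.congr_fun (hasSum_ite_eq (0 : ℕ) (ρ.1 i j)) fun n => ?_
  rcases n with _ | n <;> simp

theorem freeEvol_neg_mul (t : ℝ) : freeEvol ωA ωc γ (-t) * freeEvol ωA ωc γ t = 1 := by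
  rw [freeEvol_mul_freeEvol, neg_add_cancel, freeEvol_zero]

/-! ### The partial trace -/

theorem trB_apply (X : OpAB) (a c : Fin 2) : trB X a c = ∑' n, X.1 (a, n) (c, n) := rfl

theorem trB_leftBdag (X : OpAB) : trB (leftBdag X) = trB (rightBdag X) := by
  ext a c
  change ∑' n, (leftBdag X).1 (a, n) (c, n) = ∑' n, (rightBdag X).1 (a, n) (c, n)
  -- The term n = 0 of tr(b†X) carries the factor √0. Dropping it shifts the index and gives tr(Xb†)
  -- term by term.
  rw [(summable_diag (leftBdag X) a c).tsum_eq_zero_add]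
  simp [leftBdag, rightBdag]

theorem trB_rightB (X : OpAB) : trB (rightB X) = trB (leftB X) := by
  ext a c
  change ∑' n, (rightB X).1 (a, n) (c, n) = ∑' n, (leftB X).1 (a, n) (c, n)
  rw [(summable_diag (rightB X) a c).tsum_eq_zero_add]
  simp [leftB, rightB]

theorem trB_creL (X : OpAB) : trB (creL X) = 0 := by
  simp [creL, trB_leftBdag]

theorem trB_creR (X : OpAB) : trB (creR X) = 0 := by
  simp [creR, trB_rightB]

theorem trB_leftA (M : OpA) (X : OpAB) : trB (leftA M X) = M * trB X := by
  ext a c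
  change ∑' n, ∑ d, M a d * X.1 (d, n) (c, n) = ∑ d, M a d * ∑' n, X.1 (d, n) (c, n)
  rw [Summable.tsum_finsetSum fun d _ => (summable_diag X d c).mul_left _]
  simp only [tsum_mul_left]

theorem trB_rightA (M : OpA) (X : OpAB) : trB (rightA M X) = trB X * M := by
  ext a c
  change ∑' n, ∑ d, X.1 (a, n) (d, n) * M d c = ∑ d, (∑' n, X.1 (a, n) (d, n)) * M d c
  rw [Summable.tsum_finsetSum fun d _ => (summable_diag X a d).mul_right _]
  simp only [tsum_mul_right]

/-- Both mode terms of the normal form begin with a creator on the left, so the partial trace kills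
them and only the atomic commutator remains. -/
theorem trB_freeGen_apply (X : OpAB) (a c : Fin 2) :
    trB (freeGen ωA ωc γ X) a c = -Complex.I * ωA * (exc a - exc c) * trB X a c := by
  rw [freeGen_eq]
  simp only [atomGen, LinearMap.add_apply, LinearMap.smul_apply, Module.End.mul_apply, map_add,
    map_smul, trB_creL, trB_creR, trB_leftA, trB_rightA, smul_zero, add_zero, Matrix.add_apply,
    Matrix.smul_apply, smul_eq_mul]
  fin_cases a <;> fin_cases c <;>
    simp [Matrix.mul_apply, sigmaPlus, sigmaMinus, exc, Fin.sum_univ_two]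

theorem trB_freeGen_pow_apply (n : ℕ) (X : OpAB) (a c : Fin 2) :
    trB ((freeGen ωA ωc γ ^ n) X) a c
      = (-Complex.I * ωA * (exc a - exc c)) ^ n * trB X a c := by
  induction n with
  | zero => simp
  | succ n ih => rw [pow_succ', Module.End.mul_apply, trB_freeGen_apply, ih, pow_succ']; ring

theorem summable_series_diag (t : ℝ) (X : OpAB) (a c : Fin 2) :
    Summable fun p : ℕ × ℕ => ((t ^ p.1 / p.1.factorial : ℝ) : ℂ) *
      ((freeGen ωA ωc γ ^ p.1) X).1 (a, p.2) (c, p.2) := by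
  -- Weight r = 2 gives decay 2^{-k} in the photon number besides the 2^{-n} in the order of the
  -- series, so trace and exponential may be interchanged.
  obtain ⟨C, hC⟩ := exists_weightBound_series ωA ωc γ t X (one_le_two (α := ℝ))
  have hC0 : 0 ≤ C := by
    have h := hC 0 (a, 0) (c, 0)
    rw [pow_zero (1 / 2 : ℝ), mul_one] at h
    exact (mul_nonneg (norm_nonneg _) (by positivity)).trans h
  have hg : Summable fun p : ℕ × ℕ => (C * (1 / 2 : ℝ) ^ p.1) * (1 / 2 : ℝ) ^ p.2 :=
    (summable_geometric_two.mul_left C).mul_of_nonneg summable_geometric_two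
      (fun n => by positivity) (fun n => by positivity)
  refine Summable.of_norm_bounded hg fun p => ?_
  have h1 := hC p.1 (a, p.2) (c, p.2)
  rw [one_div_pow 2 p.2, mul_one_div, le_div_iff₀ (by positivity)]
  refine le_trans (mul_le_mul_of_nonneg_left ?_ (norm_nonneg _)) h1
  exact pow_le_pow_right₀ one_le_two (Nat.le_add_right _ _)

theorem trB_freeEvol_apply (t : ℝ) (X : OpAB) (a c : Fin 2) :
    trB (freeEvol ωA ωc γ t X) a c
      = Complex.exp (-Complex.I * ωA * (exc a - exc c) * t) * trB X a c := by
  have hsum := summable_series_diag ωA ωc γ t X a c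
  have h2 : ∀ n : ℕ, ∑' k, ((t ^ n / n.factorial : ℝ) : ℂ) *
      ((freeGen ωA ωc γ ^ n) X).1 (a, k) (c, k)
      = (-Complex.I * ωA * (exc a - exc c) * t) ^ n / n.factorial * trB X a c := by
    intro n
    rw [tsum_mul_left, ← trB_apply, trB_freeGen_pow_apply, mul_pow _ (t : ℂ)]
    push_cast
    ring
  have h3 : HasSum (fun n : ℕ => (-Complex.I * ωA * (exc a - exc c) * t) ^ n / n.factorial)
      (Complex.exp (-Complex.I * ωA * (exc a - exc c) * t)) := by
    rw [Complex.exp_eq_exp_ℂ]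
    exact NormedSpace.expSeries_div_hasSum_exp (𝔸 := ℂ) _
  rw [trB_apply, ← h3.tsum_eq, ← tsum_mul_right, ← tsum_congr h2]
  exact Summable.tsum_comm hsum

end freeEvol

/-! ### Compression to the two-level system -/

open scoped Matrix.Norms.L2Operator

/-- Left multiplication by `M`, as a superoperator on the two-level system. -/
def lmulA (M : OpA) : SuperA := LinearMap.toContinuousLinearMap (LinearMap.mulLeft ℂ M)

/-- Right multiplication by `M`, as a superoperator on the two-level system. -/
def rmulA (M : OpA) : SuperA := LinearMap.toContinuousLinearMap (LinearMap.mulRight ℂ M)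

theorem superA_smul_mul (k : ℂ) (X Y : SuperA) : (k • X) * Y = k • (X * Y) := rfl

theorem superA_mul_smul (k : ℂ) (X Y : SuperA) : X * (k • Y) = k • (X * Y) := by
  ext1 A; exact map_smul X k (Y A)

@[simp] theorem lmulA_apply (M A : OpA) : lmulA M A = M * A := rfl

@[simp] theorem rmulA_apply (M A : OpA) : rmulA M A = A * M := rfl

/-- The commutator with `M`, as a superoperator on the two-level system. -/
def adA (M : OpA) : SuperA := lmulA M + (-1 : ℂ) • rmulA M

/-- The commutator with `M ⊗ 1`. -/
def adAB (M : OpA) : Module.End ℂ OpAB := leftA M + (-1 : ℂ) • rightA M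

section compress

variable (z : ℂ)

theorem compress_apply (Y : Module.End ℂ OpAB) (A : OpA) :
    compress z Y A = trB (Y (tensorCoherent z A)) := rfl

theorem compress_one : compress z 1 = 1 := by
  ext1 A; exact trB_tensorCoherent z A

theorem compress_add (X Y : Module.End ℂ OpAB) :
    compress z (X + Y) = compress z X + compress z Y := by
  ext1 A; exact map_add trB _ _

theorem compress_smul (c : ℂ) (X : Module.End ℂ OpAB) :
    compress z (c • X) = c • compress z X := by
  ext1 A; exact map_smul trB _ _

theorem compress_leftA_mul (M : OpA) (X : Module.End ℂ OpAB) :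
    compress z (leftA M * X) = lmulA M * compress z X := by
  ext1 A; exact trB_leftA M _

theorem compress_rightA_mul (M : OpA) (X : Module.End ℂ OpAB) :
    compress z (rightA M * X) = rmulA M * compress z X := by
  ext1 A; exact trB_rightA M _

theorem compress_adAB_mul (M : OpA) (X : Module.End ℂ OpAB) :
    compress z (adAB M * X) = adA M * compress z X := by
  rw [adAB, adA, add_mul, add_mul, smul_mul_assoc, superA_smul_mul, compress_add, compress_smul,
    compress_leftA_mul, compress_rightA_mul]

theorem compress_creL_mul (X : Module.End ℂ OpAB) : compress z (creL * X) = 0 := by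
  ext1 A; exact trB_creL _

theorem compress_creR_mul (X : Module.End ℂ OpAB) : compress z (creR * X) = 0 := by
  ext1 A; exact trB_creR _

theorem leftB_tensorCoherent (A : OpA) : leftB (tensorCoherent z A) = z • tensorCoherent z A := by
  ext i j
  change ((Real.sqrt (i.2 + 1 : ℕ) : ℝ) : ℂ) *
    (A i.1 j.1 * (coherent z (i.2 + 1) * conj (coherent z j.2)))
    = z * (A i.1 j.1 * (coherent z i.2 * conj (coherent z j.2)))
  linear_combination (A i.1 j.1 * conj (coherent z j.2)) * b_coherent z i.2

theorem rightBdag_tensorCoherent (A : OpA) :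
    rightBdag (tensorCoherent z A) = conj z • tensorCoherent z A := by
  ext i j
  change ((Real.sqrt (j.2 + 1 : ℕ) : ℝ) : ℂ) *
    (A i.1 j.1 * (coherent z i.2 * conj (coherent z (j.2 + 1))))
    = conj z * (A i.1 j.1 * (coherent z i.2 * conj (coherent z j.2)))
  have h := congrArg conj (b_coherent z j.2)
  rw [map_mul, map_mul, Complex.conj_ofReal] at h
  linear_combination (A i.1 j.1 * coherent z i.2) * h

theorem compress_mul_leftB (X : Module.End ℂ OpAB) :
    compress z (X * leftB) = z • compress z X := by
  ext1 A
  rw [compress_apply, Module.End.mul_apply, leftB_tensorCoherent, map_smul, map_smul]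
  rfl

theorem compress_mul_rightBdag (X : Module.End ℂ OpAB) :
    compress z (X * rightBdag) = conj z • compress z X := by
  ext1 A
  rw [compress_apply, Module.End.mul_apply, rightBdag_tensorCoherent, map_smul, map_smul]
  rfl

end compress

/-! ### The interaction picture and its one- and two-point functions -/

section compressedGenerators

variable (ωA ωc γ : ℝ) (g z : ℂ)

theorem moment0_apply (t : ℝ) (A : OpA) (a c : Fin 2) :
    moment0 ωA ωc γ z t A a c = Complex.exp (-Complex.I * ωA * (exc a - exc c) * t) * A a c := by
  rw [moment0, compress_apply, trB_freeEvol_apply, trB_tensorCoherent]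

/-- The partial trace intertwines the free evolution with the atomic rotation for every state,
coherent or not, so `X` may be arbitrary. -/
theorem compress_freeEvol_mul (t : ℝ) (X : Module.End ℂ OpAB) :
    compress z (freeEvol ωA ωc γ t * X) = moment0 ωA ωc γ z t * compress z X := by
  ext A a c
  rw [mul_apply_eq_comp, moment0_apply, compress_apply, Module.End.mul_apply,
    trB_freeEvol_apply]
  rfl

theorem moment0_mul_moment0 (s t : ℝ) :
    moment0 ωA ωc γ z s * moment0 ωA ωc γ z t = moment0 ωA ωc γ z (s + t) := by
  nth_rw 2 [moment0]
  rw [← compress_freeEvol_mul, freeEvol_mul_freeEvol, moment0]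

theorem moment0_zero : moment0 ωA ωc γ z 0 = 1 := by
  rw [moment0, freeEvol_zero, compress_one]

theorem isUnit_moment0 (t : ℝ) : IsUnit (moment0 ωA ωc γ z t) := by
  refine ⟨⟨moment0 ωA ωc γ z t, moment0 ωA ωc γ z (-t), ?_, ?_⟩, rfl⟩ <;>
  simp [moment0_mul_moment0, moment0_zero]

/-- In the g-term, right multiplication by b is replaced by `creR + leftB`; in the ḡ-term, left
multiplication by b† by `creL + rightBdag`. Each summand then contains exactly one annihilator or
one creator. -/
theorem intGen_eq : intGen g = (-Complex.I) •
    (g • (adAB sigmaPlus * leftB) + (-g) • (rightA sigmaPlus * creR)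
      + conj g • (adAB sigmaMinus * rightBdag) + conj g • (leftA sigmaMinus * creL)) := by
  rw [intGen, adAB, adAB, creL, creR]
  simp only [end_sub_eq, add_mul, mul_add, smul_mul_assoc, mul_smul_comm]
  module

theorem IsEigenop.conj_freeEvol {μ : ℂ} {Y : Module.End ℂ OpAB}
    (h : IsEigenop (freeGen ωA ωc γ) μ Y) (hY : EntrywiseContinuous Y) (t : ℝ) :
    freeEvol ωA ωc γ (-t) * Y * freeEvol ωA ωc γ t = Complex.exp (-(μ * t)) • Y := by
  rw [h.freeEvol_mul _ _ _ hY, smul_mul_assoc, mul_assoc, freeEvol_neg_mul, mul_one]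
  push_cast
  rw [mul_neg]

theorem isEigenop_adAB {M : OpA} {μ : ℂ}
    (h : (-Complex.I * ωA) • (sigmaPlus * sigmaMinus * M - M * (sigmaPlus * sigmaMinus)) = μ • M) :
    IsEigenop (freeGen ωA ωc γ) μ (adAB M) :=
  (isEigenop_leftA h).add ((isEigenop_rightA h).smul _)

theorem EntrywiseContinuous.adAB (M : OpA) : EntrywiseContinuous (adAB M) :=
  (leftA M).add ((rightA M).smul _)

/-- Atomic and mode eigenvalues add to Γ, -Γ̄, Γ̄ and -Γ for the four summands, and conjugation by
e^{ℒ₀t} multiplies each by e^{-μt}. -/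
theorem intGenAt_eq (t : ℝ) : intGenAt ωA ωc γ g t = (-Complex.I) •
    ((g * Complex.exp (-(Γ (ωA - ωc) γ * t))) • (adAB sigmaPlus * leftB)
      + (-(g * Complex.exp (conj (Γ (ωA - ωc) γ) * t))) • (rightA sigmaPlus * creR)
      + (conj g * Complex.exp (-(conj (Γ (ωA - ωc) γ) * t))) • (adAB sigmaMinus * rightBdag)
      + (conj g * Complex.exp (Γ (ωA - ωc) γ * t)) • (leftA sigmaMinus * creL)) := by
  have hΓ : conj (Γ (ωA - ωc) γ) = Complex.I * (ωA - ωc) + γ / 2 := by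
    simp [Γ, Complex.conj_ofReal, map_ofNat]
  have h1 := ((isEigenop_adAB ωA ωc γ (comm_sigmaPlus ωA)).mul
    (isEigenop_leftB ωA ωc γ)).conj_freeEvol _ _ _
    ((EntrywiseContinuous.adAB _).mul .leftB) t
  have h2 := ((isEigenop_rightA (comm_sigmaPlus ωA)).mul
    (isEigenop_creR ωA ωc γ)).conj_freeEvol _ _ _
    ((EntrywiseContinuous.rightA _).mul .creR) t
  have h3 := ((isEigenop_adAB ωA ωc γ (comm_sigmaMinus ωA)).mul
    (isEigenop_rightBdag ωA ωc γ)).conj_freeEvol _ _ _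
    ((EntrywiseContinuous.adAB _).mul .rightBdag) t
  have h4 := ((isEigenop_leftA (comm_sigmaMinus ωA)).mul
    (isEigenop_creL ωA ωc γ)).conj_freeEvol _ _ _
    ((EntrywiseContinuous.leftA _).mul .creL) t
  rw [intGenAt, intGen_eq]
  simp only [mul_smul_comm, smul_mul_assoc, mul_add, add_mul]
  rw [h1, h2, h3, h4]
  simp only [hΓ, conj_modeRate]
  simp only [smul_smul, modeRate, Γ, neg_mul]
  push_cast
  ring_nf

/-- Only the summand with `creL` fails to commute with `leftB`. The remainder, the contraction, acts
on the atom alone. -/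
theorem leftB_mul_intGenAt (t : ℝ) : leftB * intGenAt ωA ωc γ g t = intGenAt ωA ωc γ g t * leftB
    + (-Complex.I * (conj g * Complex.exp (Γ (ωA - ωc) γ * t))) • leftA sigmaMinus := by
  have h1 : Commute leftB (adAB sigmaPlus) :=
    ((commute_leftA_leftB _).add_left ((commute_rightA_leftB _).smul_left _)).symm
  have h2 : Commute leftB (adAB sigmaMinus) :=
    ((commute_leftA_leftB _).add_left ((commute_rightA_leftB _).smul_left _)).symm
  have e1 := (h1.mul_right (Commute.refl leftB)).eq
  have e2 := ((commute_rightA_leftB sigmaPlus).symm.mul_right commute_leftB_creR).eq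
  have e3 := (h2.mul_right commute_leftB_rightBdag).eq
  have e4 : leftB * (leftA sigmaMinus * creL)
      = leftA sigmaMinus * creL * leftB + leftA sigmaMinus := by
    rw [← mul_assoc, ← (commute_leftA_leftB sigmaMinus).eq, mul_assoc, leftB_mul_creL, mul_add,
      mul_one, mul_assoc]
  rw [intGenAt_eq]
  simp only [mul_smul_comm, smul_mul_assoc, mul_add, add_mul, e1, e2, e3, e4]
  module

theorem rightBdag_mul_intGenAt (t : ℝ) :
    rightBdag * intGenAt ωA ωc γ g t = intGenAt ωA ωc γ g t * rightBdag
      + (Complex.I * (g * Complex.exp (conj (Γ (ωA - ωc) γ) * t))) • rightA sigmaPlus := by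
  have h1 : Commute rightBdag (adAB sigmaPlus) :=
    ((commute_leftA_rightBdag _).add_left ((commute_rightA_rightBdag _).smul_left _)).symm
  have h2 : Commute rightBdag (adAB sigmaMinus) :=
    ((commute_leftA_rightBdag _).add_left ((commute_rightA_rightBdag _).smul_left _)).symm
  have e1 := (h1.mul_right commute_leftB_rightBdag.symm).eq
  have e2 : rightBdag * (rightA sigmaPlus * creR)
      = rightA sigmaPlus * creR * rightBdag + rightA sigmaPlus := by
    rw [← mul_assoc, ← (commute_rightA_rightBdag sigmaPlus).eq, mul_assoc, rightBdag_mul_creR,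
      mul_add, mul_one, mul_assoc]
  have e3 := (h2.mul_right (Commute.refl rightBdag)).eq
  have e4 := ((commute_leftA_rightBdag sigmaMinus).symm.mul_right commute_rightBdag_creL).eq
  rw [intGenAt_eq]
  simp only [mul_smul_comm, smul_mul_assoc, mul_add, add_mul, e1, e2, e3, e4]
  module

/-- Creators commute with the atomic factors, can be moved to the far left, and vanish under the
trace; the two annihilator terms survive. -/
theorem compress_intGenAt_mul (t : ℝ) (X : Module.End ℂ OpAB) :
    compress z (intGenAt ωA ωc γ g t * X) =
      (-Complex.I * (g * Complex.exp (-(Γ (ωA - ωc) γ * t)))) •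
        (adA sigmaPlus * compress z (leftB * X))
      + (-Complex.I * (conj g * Complex.exp (-(conj (Γ (ωA - ωc) γ) * t)))) •
        (adA sigmaMinus * compress z (rightBdag * X)) := by
  have e2 : rightA sigmaPlus * creR * X = creR * (rightA sigmaPlus * X) := by
    rw [(commute_rightA_creR _).eq, mul_assoc]
  have e4 : leftA sigmaMinus * creL * X = creL * (leftA sigmaMinus * X) := by
    rw [(commute_leftA_creL _).eq, mul_assoc]
  rw [intGenAt_eq]
  simp only [smul_mul_assoc, add_mul, compress_add, compress_smul, e2, e4, compress_creL_mul,
    compress_creR_mul, mul_assoc _ leftB X, mul_assoc _ rightBdag X, compress_adAB_mul]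
  module

/-- The interaction-picture generator of the first order, `ρ_A ↦ tr_B ℒ(t) (ρ_A ⊗ |z⟩⟨z|)`. -/
def drive (t : ℝ) : SuperA :=
  (-Complex.I * (g * z * Complex.exp (-(Γ (ωA - ωc) γ * t)))) • adA sigmaPlus
    + (-Complex.I * (conj g * conj z * Complex.exp (-(conj (Γ (ωA - ωc) γ) * t)))) • adA sigmaMinus

theorem compress_intGenAt (t : ℝ) :
    compress z (intGenAt ωA ωc γ g t) = drive ωA ωc γ g z t := by
  have h := compress_intGenAt_mul ωA ωc γ g z t 1
  rw [mul_one, mul_one, mul_one, ← one_mul leftB, ← one_mul rightBdag, compress_mul_leftB,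
    compress_mul_rightBdag, compress_one, superA_mul_smul, superA_mul_smul, mul_one, mul_one] at h
  rw [h, drive]
  module

/-- The first of the two parts of the correlation kernel. -/
def kernelL : SuperA := adA sigmaPlus * lmulA sigmaMinus

/-- The second of the two parts of the correlation kernel. -/
def kernelR : SuperA := adA sigmaMinus * rmulA sigmaPlus

/-- The correlation kernel of the second order. -/
def kernel (Δω t : ℝ) : SuperA :=
  (-(‖g‖ ^ 2 : ℝ) * Complex.exp (-(Γ Δω γ * t)) : ℂ) • kernelL
    + ((‖g‖ ^ 2 : ℝ) * Complex.exp (-(conj (Γ Δω γ) * t)) : ℂ) • kernelR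

/-- The annihilator left over from ℒ(t) is moved through ℒ(s) to the coherent state. There it
becomes z or z̄ and yields the product of drives, while its contraction with the creator in ℒ(s)
yields the kernel. -/
theorem compress_intGenAt_mul_intGenAt (t s : ℝ) :
    compress z (intGenAt ωA ωc γ g t * intGenAt ωA ωc γ g s)
      = drive ωA ωc γ g z t * drive ωA ωc γ g z s + kernel γ g (ωA - ωc) (t - s) := by
  have hg : ((‖g‖ ^ 2 : ℝ) : ℂ) = g * conj g := by
    rw [Complex.mul_conj, Complex.normSq_eq_norm_sq]
  have h1 : Complex.exp (-(Γ (ωA - ωc) γ * (t - s : ℝ)))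
      = Complex.exp (-(Γ (ωA - ωc) γ * t)) * Complex.exp (Γ (ωA - ωc) γ * s) := by
    rw [← Complex.exp_add]; push_cast; ring_nf
  have h2 : Complex.exp (-(conj (Γ (ωA - ωc) γ) * (t - s : ℝ)))
      = Complex.exp (-(conj (Γ (ωA - ωc) γ) * t)) * Complex.exp (conj (Γ (ωA - ωc) γ) * s) := by
    rw [← Complex.exp_add]; push_cast; ring_nf
  have hl : compress z (leftA sigmaMinus) = lmulA sigmaMinus := by
    rw [← mul_one (leftA sigmaMinus), compress_leftA_mul, compress_one, mul_one]
  have hr : compress z (rightA sigmaPlus) = rmulA sigmaPlus := by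
    rw [← mul_one (rightA sigmaPlus), compress_rightA_mul, compress_one, mul_one]
  rw [compress_intGenAt_mul, leftB_mul_intGenAt, rightBdag_mul_intGenAt, compress_add,
    compress_add, compress_mul_leftB, compress_mul_rightBdag, compress_smul, compress_smul, hl, hr,
    compress_intGenAt, kernel, h1, h2, hg, kernelL, kernelR]
  -- The drive at time s is kept opaque so that only the one at time t is expanded.
  generalize drive ωA ωc γ g z s = D
  rw [drive]
  simp only [mul_add, add_mul, superA_mul_smul, superA_smul_mul, smul_add, smul_smul]
  match_scalars <;> ring_nf <;> simp only [Complex.I_sq] <;> ring_nf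

theorem integrand1_eq (t s : ℝ) : integrand1 ωA ωc γ g z t s
    = moment0 ωA ωc γ z t * drive ωA ωc γ g z s := by
  rw [integrand1, compress_freeEvol_mul, compress_intGenAt]

theorem integrand2_eq (t s r : ℝ) : integrand2 ωA ωc γ g z t s r
    = moment0 ωA ωc γ z t *
      (drive ωA ωc γ g z s * drive ωA ωc γ g z r + kernel γ g (ωA - ωc) (s - r)) := by
  rw [integrand2, mul_assoc, compress_freeEvol_mul, compress_intGenAt_mul_intGenAt]

end compressedGenerators

/-! ### The second cumulant in a Banach algebra -/

section BanachAlgebra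

open MeasureTheory

variable {𝔸 : Type*} [NormedRing 𝔸] {V D N : ℝ → 𝔸}

theorem integrand_continuous (hD : Continuous D) (hN : Continuous N) (x : 𝔸) :
    (Continuous fun s => x * D s) ∧
      Continuous fun p : ℝ × ℝ => x * (D p.1 * D p.2 + N (p.1 - p.2)) :=
  ⟨by fun_prop, by fun_prop⟩

variable [NormedAlgebra ℝ 𝔸]

theorem continuous_secondMoment (hD : Continuous D) (hN : Continuous N) :
    Continuous fun s => D s * (∫ r in (0 : ℝ)..s, D r) + ∫ r in (0 : ℝ)..s, N r :=
  (hD.mul (intervalIntegral.continuous_primitive (fun _ _ => hD.intervalIntegrable _ _) 0)).add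
    (intervalIntegral.continuous_primitive (fun _ _ => hN.intervalIntegrable _ _) 0)

variable [CompleteSpace 𝔸]

theorem intervalIntegral_mul_left (x : 𝔸) {f : ℝ → 𝔸} (hf : Continuous f) (a b : ℝ) :
    ∫ s in a..b, x * f s = x * ∫ s in a..b, f s :=
  (ContinuousLinearMap.mul ℝ 𝔸 x).intervalIntegral_comp_comm (hf.intervalIntegrable a b)

theorem hasDerivAt_firstMoment (hV : Differentiable ℝ V) (hD : Continuous D) (t : ℝ) :
    HasDerivAt (fun t => ∫ s in (0 : ℝ)..t, V t * D s)
      (deriv V t * (∫ s in (0 : ℝ)..t, D s) + V t * D t) t := by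
  simp only [intervalIntegral_mul_left _ hD]
  exact (hV t).hasDerivAt.mul (hD.integral_hasStrictDerivAt 0 t).hasDerivAt

theorem differentiable_firstMoment (hV : Differentiable ℝ V) (hD : Continuous D) :
    Differentiable ℝ fun t => ∫ s in (0 : ℝ)..t, V t * D s :=
  fun t => (hasDerivAt_firstMoment hV hD t).differentiableAt

/-- The substitution r ↦ s - r turns the convolution-type term into a primitive of `N`. -/
theorem integral_secondMoment (hD : Continuous D) (hN : Continuous N) (x : 𝔸) (s : ℝ) :
    ∫ r in (0 : ℝ)..s, x * (D s * D r + N (s - r))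
      = x * (D s * (∫ r in (0 : ℝ)..s, D r) + ∫ r in (0 : ℝ)..s, N r) := by
  rw [intervalIntegral_mul_left _ (by fun_prop), intervalIntegral.integral_add
    (Continuous.intervalIntegrable (by fun_prop) _ _)
    (Continuous.intervalIntegrable (by fun_prop) _ _), intervalIntegral_mul_left _ hD,
    intervalIntegral.integral_comp_sub_left]
  simp

theorem secondMoment_eq (hD : Continuous D) (hN : Continuous N) (t : ℝ) :
    ∫ s in (0 : ℝ)..t, ∫ r in (0 : ℝ)..s, V t * (D s * D r + N (s - r))
      = V t * ∫ s in (0 : ℝ)..t,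
        (D s * (∫ r in (0 : ℝ)..s, D r) + ∫ r in (0 : ℝ)..s, N r) := by
  simp only [integral_secondMoment hD hN]
  exact intervalIntegral_mul_left _ (continuous_secondMoment hD hN) _ _

theorem hasDerivAt_secondMoment (hV : Differentiable ℝ V) (hD : Continuous D) (hN : Continuous N)
    (t : ℝ) :
    HasDerivAt (fun t => ∫ s in (0 : ℝ)..t, ∫ r in (0 : ℝ)..s, V t * (D s * D r + N (s - r)))
      (deriv V t * (∫ s in (0 : ℝ)..t,
          (D s * (∫ r in (0 : ℝ)..s, D r) + ∫ r in (0 : ℝ)..s, N r))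
        + V t * (D t * (∫ r in (0 : ℝ)..t, D r) + ∫ r in (0 : ℝ)..t, N r)) t := by
  simp only [secondMoment_eq hD hN]
  exact (hV t).hasDerivAt.mul
    ((continuous_secondMoment hD hN).integral_hasStrictDerivAt 0 t).hasDerivAt

theorem differentiable_secondMoment (hV : Differentiable ℝ V) (hD : Continuous D)
    (hN : Continuous N) :
    Differentiable ℝ fun t =>
      ∫ s in (0 : ℝ)..t, ∫ r in (0 : ℝ)..s, V t * (D s * D r + N (s - r)) :=
  fun t => (hasDerivAt_secondMoment hV hD hN t).differentiableAt

/-- The terms with V̇ from the product rule in Ȯ₂ and Ȯ₁ cancel against the last two terms of the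
cumulant. The product V D(t)∫D in Ȯ₂ cancels against Ȯ₁V⁻¹O₁V⁻¹. No commutativity is used, so the
conjugation by V remains. -/
theorem secondCumulant_eq (hV : Differentiable ℝ V) (hD : Continuous D) (hN : Continuous N)
    (hU : ∀ t, IsUnit (V t)) {O₁ O₂ : ℝ → 𝔸} (hO₁ : O₁ = fun t => ∫ s in (0 : ℝ)..t, V t * D s)
    (hO₂ : O₂ = fun t => ∫ s in (0 : ℝ)..t, ∫ r in (0 : ℝ)..s, V t * (D s * D r + N (s - r)))
    (t : ℝ) :
    deriv O₂ t * Ring.inverse (V t)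
      - deriv O₁ t * Ring.inverse (V t) * O₁ t * Ring.inverse (V t)
      - deriv V t * Ring.inverse (V t) * O₂ t * Ring.inverse (V t)
      + deriv V t * Ring.inverse (V t) * O₁ t * Ring.inverse (V t) * O₁ t * Ring.inverse (V t)
      = V t * (∫ r in (0 : ℝ)..t, N r) * Ring.inverse (V t) := by
  have hR : ∀ x : 𝔸, Ring.inverse (V t) * (V t * x) = x := fun x => by
    rw [← mul_assoc, Ring.inverse_mul_cancel _ (hU t), one_mul]
  have h1 : deriv O₁ t = _ := hO₁ ▸ (hasDerivAt_firstMoment hV hD t).deriv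
  have h2 : deriv O₂ t = _ := hO₂ ▸ (hasDerivAt_secondMoment hV hD hN t).deriv
  have e1 : O₁ t = V t * ∫ s in (0 : ℝ)..t, D s := by
    rw [hO₁]; exact intervalIntegral_mul_left _ hD _ _
  have e2 := congrFun hO₂ t
  simp only [secondMoment_eq hD hN] at e2
  rw [h1, h2, e1, e2]
  simp only [mul_add, add_mul, mul_assoc, hR]
  abel

end BanachAlgebra

/-! ### The moments of the model and the reduction to the integrated kernel -/

section NormedSpace

variable {E : Type*} [NormedAddCommGroup E] [NormedSpace ℝ E] [NormedSpace ℂ E]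

theorem integral_smul_add_smul [CompleteSpace E] {p q : ℝ → ℂ} (hp : Continuous p)
    (hq : Continuous q) (x y : E) (a b : ℝ) :
    ∫ s in a..b, (p s • x + q s • y) = (∫ s in a..b, p s) • x + (∫ s in a..b, q s) • y := by
  have h1 : IntervalIntegrable (fun s => p s • x) MeasureTheory.volume a b :=
    (hp.smul continuous_const).intervalIntegrable _ _
  have h2 : IntervalIntegrable (fun s => q s • y) MeasureTheory.volume a b :=
    (hq.smul continuous_const).intervalIntegrable _ _
  rw [intervalIntegral.integral_add h1 h2, intervalIntegral.integral_smul_const,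
    intervalIntegral.integral_smul_const]

theorem differentiable_smul_add_smul [IsScalarTower ℝ ℂ E] {p q : ℝ → ℂ} (hp : Differentiable ℝ p)
    (hq : Differentiable ℝ q) (w x y : E) :
    Differentiable ℝ fun t => w + (p t • x + q t • y) :=
  (differentiable_const w).add ((hp.smul_const x).add (hq.smul_const y))

end NormedSpace

instance : IsScalarTower ℝ ℂ SuperA := ⟨fun x y Z => by
  ext A a c
  exact smul_assoc x y (Z A a c)⟩

variable (ωA ωc γ Δω : ℝ) (g z : ℂ)

theorem continuous_drive : Continuous (drive ωA ωc γ g z) := by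
  unfold drive; fun_prop

theorem continuous_kernel : Continuous (kernel γ g Δω) := by
  unfold kernel; fun_prop

/-- Populations are fixed and the two coherences rotate. Here σ⁺σ⁻ and σ⁻σ⁺ are the projections on
the excited and the ground state; this form makes differentiability in t evident. -/
theorem moment0_eq (t : ℝ) : moment0 ωA ωc γ z t
    = (lmulA (sigmaPlus * sigmaMinus) * rmulA (sigmaPlus * sigmaMinus)
        + lmulA (sigmaMinus * sigmaPlus) * rmulA (sigmaMinus * sigmaPlus))
      + (Complex.exp (-Complex.I * ωA * t) •
          (lmulA (sigmaPlus * sigmaMinus) * rmulA (sigmaMinus * sigmaPlus))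
        + Complex.exp (Complex.I * ωA * t) •
          (lmulA (sigmaMinus * sigmaPlus) * rmulA (sigmaPlus * sigmaMinus))) := by
  ext A a c
  rw [moment0_apply]
  simp only [add_apply, smul_apply, mul_apply_eq_comp, lmulA_apply, rmulA_apply,
    Matrix.add_apply, Matrix.smul_apply, smul_eq_mul, Matrix.mul_apply, Fin.sum_univ_two]
  fin_cases a <;> fin_cases c <;> simp [sigmaPlus, sigmaMinus, exc]

theorem differentiable_moment0 : Differentiable ℝ (moment0 ωA ωc γ z) := by
  rw [funext (moment0_eq ωA ωc γ z)]
  exact differentiable_smul_add_smul (E := SuperA)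
    (p := fun t : ℝ => Complex.exp (-Complex.I * ωA * t))
    (q := fun t : ℝ => Complex.exp (Complex.I * ωA * t)) (by fun_prop) (by fun_prop) _ _ _

/-- The kernel contains one σ⁺ and one σ⁻, so the phases they acquire under the atomic rotation
cancel. -/
theorem commute_moment0_kernelL (t : ℝ) : Commute (moment0 ωA ωc γ z t) kernelL := by
  ext A a c
  simp only [kernelL, adA, add_apply, smul_apply, mul_apply_eq_comp, lmulA_apply,
    rmulA_apply, moment0_apply, Matrix.add_apply, Matrix.smul_apply, smul_eq_mul, Matrix.mul_apply,
    Fin.sum_univ_two]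
  fin_cases a <;> fin_cases c <;> simp [sigmaPlus, sigmaMinus, exc]

theorem commute_moment0_kernelR (t : ℝ) : Commute (moment0 ωA ωc γ z t) kernelR := by
  ext A a c
  simp only [kernelR, adA, add_apply, smul_apply, mul_apply_eq_comp, lmulA_apply,
    rmulA_apply, moment0_apply, Matrix.add_apply, Matrix.smul_apply, smul_eq_mul, Matrix.mul_apply,
    Fin.sum_univ_two]
  fin_cases a <;> fin_cases c <;> simp [sigmaPlus, sigmaMinus, exc]

theorem moment1_eq : moment1 ωA ωc γ g z
    = fun t => ∫ s in (0 : ℝ)..t, moment0 ωA ωc γ z t * drive ωA ωc γ g z s := by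
  funext t
  simp only [moment1, integrand1_eq]

theorem moment2_eq : moment2 ωA ωc γ g z
    = fun t => ∫ s in (0 : ℝ)..t, ∫ r in (0 : ℝ)..s, moment0 ωA ωc γ z t *
      (drive ωA ωc γ g z s * drive ωA ωc γ g z r + kernel γ g (ωA - ωc) (s - r)) := by
  funext t
  simp only [moment2, integrand2_eq]

theorem continuous_integrand1 (t : ℝ) : Continuous fun s => integrand1 ωA ωc γ g z t s := by
  simp only [integrand1_eq]
  exact (integrand_continuous (𝔸 := SuperA) (continuous_drive ωA ωc γ g z)
    (continuous_kernel γ (ωA - ωc) g) _).1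

theorem continuous_integrand2 (t : ℝ) :
    Continuous fun p : ℝ × ℝ => integrand2 ωA ωc γ g z t p.1 p.2 := by
  simp only [integrand2_eq]
  exact (integrand_continuous (𝔸 := SuperA) (continuous_drive ωA ωc γ g z)
    (continuous_kernel γ (ωA - ωc) g) _).2

theorem differentiable_moment1 : Differentiable ℝ (moment1 ωA ωc γ g z) := by
  rw [moment1_eq]
  exact differentiable_firstMoment (𝔸 := SuperA) (differentiable_moment0 ωA ωc γ z)
    (continuous_drive ωA ωc γ g z)

theorem differentiable_moment2 : Differentiable ℝ (moment2 ωA ωc γ g z) := by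
  rw [moment2_eq]
  exact differentiable_secondMoment (𝔸 := SuperA) (differentiable_moment0 ωA ωc γ z)
    (continuous_drive ωA ωc γ g z) (continuous_kernel γ (ωA - ωc) g)

theorem cumulant2_eq_conj_integral (t : ℝ) : cumulant2 ωA ωc γ g z t
    = moment0 ωA ωc γ z t * (∫ r in (0 : ℝ)..t, kernel γ g (ωA - ωc) r)
      * Ring.inverse (moment0 ωA ωc γ z t) :=
  secondCumulant_eq (𝔸 := SuperA) (differentiable_moment0 ωA ωc γ z) (continuous_drive ωA ωc γ g z)
    (continuous_kernel γ (ωA - ωc) g) (isUnit_moment0 ωA ωc γ z) (moment1_eq ωA ωc γ g z)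
    (moment2_eq ωA ωc γ g z) t

/-! ### Closed form of the cumulant -/

theorem norm_Γ_sq : ‖Γ Δω γ‖ ^ 2 = Δω ^ 2 + 1 / 4 * γ ^ 2 := by
  rw [← Complex.normSq_eq_norm_sq, Complex.normSq_apply]
  simp [Γ]
  ring

theorem integral_exp_neg_mul {c : ℂ} (hc : c ≠ 0) (t : ℝ) :
    ∫ r in (0 : ℝ)..t, Complex.exp (-(c * r)) = (1 - Complex.exp (-(c * t))) / c := by
  have h := integral_exp_mul_complex (a := 0) (b := t) (neg_ne_zero.mpr hc)
  simp only [neg_mul] at h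
  rw [h]
  simp only [Complex.ofReal_zero, mul_zero, neg_zero, Complex.exp_zero]
  rw [div_neg, ← neg_div, neg_sub]

theorem integral_kernel (hΓ : Γ Δω γ ≠ 0) (t : ℝ) :
    ∫ r in (0 : ℝ)..t, kernel γ g Δω r
      = (-(‖g‖ ^ 2 : ℝ) * ((1 - Complex.exp (-(Γ Δω γ * t))) / Γ Δω γ) : ℂ) • kernelL
        + ((‖g‖ ^ 2 : ℝ) * ((1 - Complex.exp (-(conj (Γ Δω γ) * t))) / conj (Γ Δω γ)) : ℂ)
          • kernelR := by
  have hΓ' : conj (Γ Δω γ) ≠ 0 := (map_ne_zero _).mpr hΓ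
  rw [← integral_exp_neg_mul hΓ, ← integral_exp_neg_mul hΓ', ← intervalIntegral.integral_const_mul,
    ← intervalIntegral.integral_const_mul]
  exact integral_smul_add_smul (E := SuperA)
    (p := fun r : ℝ => -(‖g‖ ^ 2 : ℝ) * Complex.exp (-(Γ Δω γ * r)))
    (q := fun r : ℝ => (‖g‖ ^ 2 : ℝ) * Complex.exp (-(conj (Γ Δω γ) * r)))
    (by fun_prop) (by fun_prop) _ _ _ _

/-- Expanding by Γ̄ produces the denominator |Γ|². The functions f₂ and φ₂ are the real and
imaginary parts of -2Γ̄e^{-Γt}, and 2Γ̄ = γ + 2iΔω. -/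
theorem one_sub_exp_div_Γ (hΓ : Γ Δω γ ≠ 0) (t : ℝ) :
    (1 - Complex.exp (-(Γ Δω γ * t))) / Γ Δω γ
      = ((1 / (2 * ‖Γ Δω γ‖ ^ 2) : ℝ) : ℂ)
        * ((γ + f₂ Δω γ t : ℝ) + (2 * Δω + φ₂ Δω γ t : ℝ) * Complex.I) := by
  have hexp : Complex.exp (-(Γ Δω γ * t)) = ((Real.exp (-(1 / 2) * γ * t) : ℝ) : ℂ) *
      ((Real.cos (Δω * t) : ℝ) + (Real.sin (Δω * t) : ℝ) * Complex.I) := by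
    have : -(Γ Δω γ * t) = ((-(1 / 2) * γ * t : ℝ) : ℂ) + ((Δω * t : ℝ) : ℂ) * Complex.I := by
      rw [Γ]; push_cast; ring
    rw [this, Complex.exp_add, Complex.exp_mul_I, Complex.ofReal_exp, Complex.ofReal_cos,
      Complex.ofReal_sin]
  have hn : ((‖Γ Δω γ‖ ^ 2 : ℝ) : ℂ) = Δω ^ 2 + 1 / 4 * γ ^ 2 := by
    rw [norm_Γ_sq]; push_cast; ring
  have hn0 : ((‖Γ Δω γ‖ ^ 2 : ℝ) : ℂ) ≠ 0 := by
    exact_mod_cast pow_ne_zero 2 (norm_ne_zero_iff.mpr hΓ)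
  have hc : ((1 / (2 * ‖Γ Δω γ‖ ^ 2) : ℝ) : ℂ) = 1 / (2 * (‖Γ Δω γ‖ ^ 2 : ℝ)) := by push_cast; ring
  rw [hexp, hc, div_eq_iff hΓ, eq_comm, mul_assoc, one_div_mul_eq_div,
    div_eq_iff (mul_ne_zero two_ne_zero hn0), hn, f₂, φ₂, Γ]
  generalize Real.exp (-(1 / 2) * γ * t) = e
  generalize Real.cos (Δω * t) = c
  generalize Real.sin (Δω * t) = s
  push_cast
  ring_nf
  simp only [Complex.I_sq]
  ring

/-- The dissipator of `σ⁻`, as a superoperator on the two-level system. -/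
def decay : SuperA := lmulA sigmaMinus * rmulA sigmaPlus
  + (-(1 / 2) : ℂ) • (lmulA (sigmaPlus * sigmaMinus) + rmulA (sigmaPlus * sigmaMinus))

theorem kernelL_eq :
    kernelL = (-1 : ℂ) • decay + (1 / 2 : ℂ) • adA (sigmaPlus * sigmaMinus) := by
  ext A a c
  simp only [kernelL, decay, adA, add_apply, smul_apply, mul_apply_eq_comp, lmulA_apply,
    rmulA_apply, Matrix.add_apply, Matrix.smul_apply, smul_eq_mul, Matrix.mul_apply,
    Fin.sum_univ_two]
  fin_cases a <;> fin_cases c <;> simp [sigmaPlus, sigmaMinus] <;> ring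

theorem kernelR_eq : kernelR = decay + (1 / 2 : ℂ) • adA (sigmaPlus * sigmaMinus) := by
  ext A a c
  simp only [kernelR, decay, adA, add_apply, smul_apply, mul_apply_eq_comp, lmulA_apply,
    rmulA_apply, Matrix.add_apply, Matrix.smul_apply, smul_eq_mul, Matrix.mul_apply,
    Fin.sum_univ_two]
  fin_cases a <;> fin_cases c <;> simp [sigmaPlus, sigmaMinus] <;> ring

/-- With h = (1 - e^{-Γt})/Γ the cumulant is |g|²(-h `kernelL` + h̄ `kernelR`). The two kernels have
opposite dissipative parts and equal commutator parts, so 2 Re h multiplies the dissipator and -i Im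
h the commutator. -/
theorem cumulant2_eq (hΓ : Γ (ωA - ωc) γ ≠ 0) (t : ℝ) :
    cumulant2 ωA ωc γ g z t
      = (-Complex.I * ((‖g‖ ^ 2 / (2 * ‖Γ (ωA - ωc) γ‖ ^ 2) *
          (2 * (ωA - ωc) + φ₂ (ωA - ωc) γ t) : ℝ) : ℂ)) • adA (sigmaPlus * sigmaMinus)
        + ((‖g‖ ^ 2 / ‖Γ (ωA - ωc) γ‖ ^ 2 * (γ + f₂ (ωA - ωc) γ t) : ℝ) : ℂ) • decay := by
  set Δ := ωA - ωc
  have hconj : (1 - Complex.exp (-(conj (Γ Δ γ) * t))) / conj (Γ Δ γ)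
      = ((1 / (2 * ‖Γ Δ γ‖ ^ 2) : ℝ) : ℂ)
        * ((γ + f₂ Δ γ t : ℝ) - (2 * Δ + φ₂ Δ γ t : ℝ) * Complex.I) := by
    have h := congrArg conj (one_sub_exp_div_Γ γ Δ hΓ t)
    simp only [map_div₀, map_sub, map_one, map_mul, map_add, ← Complex.exp_conj, map_neg,
      Complex.conj_ofReal, Complex.conj_I] at h
    rw [h]; ring
  have hcomm : Commute (moment0 ωA ωc γ z t) (∫ r in (0 : ℝ)..t, kernel γ g Δ r) := by
    rw [integral_kernel _ _ _ hΓ, commute_iff_eq]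
    simp only [mul_add, add_mul, superA_mul_smul, superA_smul_mul,
      (commute_moment0_kernelL ωA ωc γ z t).eq, (commute_moment0_kernelR ωA ωc γ z t).eq]
  rw [cumulant2_eq_conj_integral, hcomm.eq, mul_assoc,
    Ring.mul_inverse_cancel _ (isUnit_moment0 ωA ωc γ z t), mul_one, integral_kernel _ _ _ hΓ,
    one_sub_exp_div_Γ _ _ hΓ, hconj, kernelL_eq, kernelR_eq]
  match_scalars <;> ring

/-! ### The long-time limit and its GKSL form -/

theorem tendsto_exp_mul_zero {γ : ℝ} (hγ : 0 < γ) {u : ℝ → ℝ} {C : ℝ} (hu : ∀ t, |u t| ≤ C) :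
    Tendsto (fun t => Real.exp (-(1 / 2) * γ * t) * u t) atTop (𝓝 0) := by
  have h1 : Tendsto (fun t => Real.exp (-(1 / 2) * γ * t)) atTop (𝓝 0) :=
    Real.tendsto_exp_atBot.comp (tendsto_id.const_mul_atTop_of_neg (by linarith))
  exact h1.zero_mul_isBoundedUnder_le (isBoundedUnder_of ⟨C, hu⟩)

theorem tendsto_f₂ {γ : ℝ} (hγ : 0 < γ) : Tendsto (f₂ Δω γ) atTop (𝓝 0) := by
  refine tendsto_exp_mul_zero hγ (C := |2 * Δω| + |γ|) fun t => (abs_sub _ _).trans ?_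
  rw [abs_mul, abs_mul γ]
  exact add_le_add (mul_le_of_le_one_right (abs_nonneg _) (Real.abs_sin_le_one _))
    (mul_le_of_le_one_right (abs_nonneg _) (Real.abs_cos_le_one _))

theorem tendsto_φ₂ {γ : ℝ} (hγ : 0 < γ) : Tendsto (φ₂ Δω γ) atTop (𝓝 0) := by
  refine tendsto_exp_mul_zero hγ (C := |-2 * Δω| + |γ|) fun t => (abs_sub _ _).trans ?_
  rw [abs_mul, abs_mul γ]
  exact add_le_add (mul_le_of_le_one_right (abs_nonneg _) (Real.abs_cos_le_one _))
    (mul_le_of_le_one_right (abs_nonneg _) (Real.abs_sin_le_one _))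

theorem gksl_eq (x y : ℝ) :
    gksl ((x : ℂ) • (sigmaPlus * sigmaMinus)) ((y : ℂ) • sigmaMinus)
      = (-Complex.I * x) • adA (sigmaPlus * sigmaMinus) + ((y ^ 2 : ℝ) : ℂ) • decay := by
  have hs : sigmaMinus.conjTranspose = sigmaPlus := by
    ext a c; fin_cases a <;> fin_cases c <;> simp [sigmaPlus, sigmaMinus]
  ext1 A
  change (-Complex.I) • ((x : ℂ) • (sigmaPlus * sigmaMinus) * A
      - A * ((x : ℂ) • (sigmaPlus * sigmaMinus)))
    + ((y : ℂ) • sigmaMinus * (A * ((y : ℂ) • sigmaMinus).conjTranspose)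
      - (1 / 2 : ℂ) • (((y : ℂ) • sigmaMinus).conjTranspose * ((y : ℂ) • sigmaMinus) * A
        + A * (((y : ℂ) • sigmaMinus).conjTranspose * ((y : ℂ) • sigmaMinus))))
    = (-Complex.I * x) • (sigmaPlus * sigmaMinus * A + (-1 : ℂ) • (A * (sigmaPlus * sigmaMinus)))
      + ((y ^ 2 : ℝ) : ℂ) • (sigmaMinus * (A * sigmaPlus)
        + (-(1 / 2) : ℂ) • (sigmaPlus * sigmaMinus * A + A * (sigmaPlus * sigmaMinus)))
  rw [Matrix.conjTranspose_smul, hs, Complex.star_def, Complex.conj_ofReal]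
  simp only [Matrix.smul_mul, Matrix.mul_smul]
  push_cast
  module

theorem isHermitian_smul_number (x : ℝ) :
    ((x : ℂ) • (sigmaPlus * sigmaMinus)).IsHermitian := by
  ext a c
  fin_cases a <;> fin_cases c <;> simp [sigmaPlus, sigmaMinus]

theorem tendsto_cumulant2 (hΓ : Γ (ωA - ωc) γ ≠ 0) (hγ : 0 < γ) :
    Tendsto (cumulant2 ωA ωc γ g z) atTop
      (𝓝 (gksl ((((ωA - ωc) * ‖g‖ ^ 2 / ‖Γ (ωA - ωc) γ‖ ^ 2 : ℝ) : ℂ) • (sigmaPlus * sigmaMinus))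
        (((√γ * ‖g‖ / ‖Γ (ωA - ωc) γ‖ : ℝ) : ℂ) • sigmaMinus))) := by
  rw [gksl_eq, funext (cumulant2_eq ωA ωc γ g z hΓ)]
  have h1 := ((tendsto_φ₂ (ωA - ωc) hγ).const_add (2 * (ωA - ωc))).const_mul
    (‖g‖ ^ 2 / (2 * ‖Γ (ωA - ωc) γ‖ ^ 2))
  have h2 := ((tendsto_f₂ (ωA - ωc) hγ).const_add γ).const_mul (‖g‖ ^ 2 / ‖Γ (ωA - ωc) γ‖ ^ 2)
  have e1 : ‖g‖ ^ 2 / (2 * ‖Γ (ωA - ωc) γ‖ ^ 2) * (2 * (ωA - ωc) + 0)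
      = (ωA - ωc) * ‖g‖ ^ 2 / ‖Γ (ωA - ωc) γ‖ ^ 2 := by field_simp; ring
  have e2 : ‖g‖ ^ 2 / ‖Γ (ωA - ωc) γ‖ ^ 2 * (γ + 0) = (√γ * ‖g‖ / ‖Γ (ωA - ωc) γ‖) ^ 2 := by
    rw [div_pow, mul_pow, Real.sq_sqrt hγ.le]; ring
  rw [e1] at h1
  rw [e2] at h2
  exact (((Complex.continuous_ofReal.tendsto _).comp h1).const_mul (-Complex.I)).smul_const _ |>.add
    (((Complex.continuous_ofReal.tendsto _).comp h2).smul_const _)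

theorem extend_cumulant2_apply (hΓ : Γ (ωA - ωc) γ ≠ 0) (t : ℝ) (ρ : OpAB) :
    extend z (cumulant2 ωA ωc γ g z t) ρ =
      tensorCoherent z
        ((-Complex.I * ((‖g‖ ^ 2 / (2 * ‖Γ (ωA - ωc) γ‖ ^ 2) *
            (2 * (ωA - ωc) + φ₂ (ωA - ωc) γ t) : ℝ) : ℂ)) •
          (sigmaPlus * sigmaMinus * trB ρ - trB ρ * (sigmaPlus * sigmaMinus)) +
        ((‖g‖ ^ 2 / ‖Γ (ωA - ωc) γ‖ ^ 2 * (γ + f₂ (ωA - ωc) γ t) : ℝ) : ℂ) •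
          (sigmaMinus * trB ρ * sigmaPlus - (1 / 2 : ℂ) •
            (sigmaPlus * sigmaMinus * trB ρ + trB ρ * (sigmaPlus * sigmaMinus)))) := by
  change tensorCoherent z (cumulant2 ωA ωc γ g z t (trB ρ)) = _
  rw [cumulant2_eq ωA ωc γ g z hΓ t]
  congr 1
  simp only [adA, decay, add_apply, smul_apply, mul_apply_eq_comp, lmulA_apply, rmulA_apply,
    ← mul_assoc]
  module

end DissipativeJC
end

open DissipativeJC

theorem mainTheorem1 (ωA ωc γ Δω : ℝ) (g z : ℂ) (hγ : 0 ≤ γ) (hΔω : Δω = ωA - ωc)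
    (hΓ : Γ Δω γ ≠ 0) :
    ‖Γ Δω γ‖ ^ 2 = Δω ^ 2 + 1 / 4 * γ ^ 2 ∧
    -- the inverse, the integrals and the derivatives in the cumulant exist
    (∀ t, IsUnit (moment0 ωA ωc γ z t)) ∧
    (∀ t, Continuous fun t₁ : ℝ => integrand1 ωA ωc γ g z t t₁) ∧
    (∀ t, Continuous fun p : ℝ × ℝ => integrand2 ωA ωc γ g z t p.1 p.2) ∧
    Differentiable ℝ (moment0 ωA ωc γ z) ∧
    Differentiable ℝ (moment1 ωA ωc γ g z) ∧
    Differentiable ℝ (moment2 ωA ωc γ g z) ∧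
    -- the closed form
    (∀ t : ℝ, 0 ≤ t → ∀ ρ : OpAB,
      extend z (cumulant2 ωA ωc γ g z t) ρ =
        tensorCoherent z
          ((-Complex.I * ((‖g‖ ^ 2 / (2 * ‖Γ Δω γ‖ ^ 2) * (2 * Δω + φ₂ Δω γ t) : ℝ) : ℂ)) •
              (sigmaPlus * sigmaMinus * trB ρ - trB ρ * (sigmaPlus * sigmaMinus)) +
            ((‖g‖ ^ 2 / ‖Γ Δω γ‖ ^ 2 * (γ + f₂ Δω γ t) : ℝ) : ℂ) •
              (sigmaMinus * trB ρ * sigmaPlus - (1 / 2 : ℂ) •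
                (sigmaPlus * sigmaMinus * trB ρ + trB ρ * (sigmaPlus * sigmaMinus))))) ∧
    -- the limit
    (0 < γ →
      (((Δω * ‖g‖ ^ 2 / ‖Γ Δω γ‖ ^ 2 : ℝ) : ℂ) • (sigmaPlus * sigmaMinus)).IsHermitian ∧
      Tendsto (cumulant2 ωA ωc γ g z) atTop
        (𝓝 (gksl (((Δω * ‖g‖ ^ 2 / ‖Γ Δω γ‖ ^ 2 : ℝ) : ℂ) • (sigmaPlus * sigmaMinus))
          (((√γ * ‖g‖ / ‖Γ Δω γ‖ : ℝ) : ℂ) • sigmaMinus)))) := by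
  subst hΔω
  exact ⟨norm_Γ_sq γ _, isUnit_moment0 ωA ωc γ z, continuous_integrand1 ωA ωc γ g z,
    continuous_integrand2 ωA ωc γ g z, differentiable_moment0 ωA ωc γ z,
    differentiable_moment1 ωA ωc γ g z, differentiable_moment2 ωA ωc γ g z,
    fun t _ ρ => extend_cumulant2_apply ωA ωc γ g z hΓ t ρ,
    fun hγ => ⟨isHermitian_smul_number _, tendsto_cumulant2 ωA ωc γ g z hΓ hγ⟩⟩
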